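/- Let $M$ be a smooth (Hausdorff, second countable) $n$-manifold, $\Omega(M)$ its algebra of differential forms with the $\mathbb Z/2$-grading by degree, regarded as the algebra of superfunctions of the Cartan–Koszul supermanifold $(M,\Omega(M))$, and $\mathrm{Der}\,\Omega(M)$ the left $\Omega(M)$-module of superderivations (supervector fields), with graded commutator $[\cdot,\cdot]$. Let $H:TM\to T^*M$ be a vector bundle isomorphism such that $H(X,Y)=H(X)(Y)$ is either a Riemannian metric or a symplectic form, and let $\nabla$ be a torsion-free linear connection on $M$ with $\nabla H=0$. Write $\nabla_X$ (even) and $i_X$ (odd) for the covariant derivative and the insertion, as derivations of $\Omega(M)$. Let $\lambda_H$ be the left $\Omega(M)$-linear form on $\mathrm{Der}\,\Omega(M)$ with $\langle\nabla_X;\lambda_H\rangle=H(X)$, $\langle i_X;\lambda_H\rangle=0$, and let $\omega=\omega_H=\mathbf d\lambda_H$, i.e. $\langle D,D';\omega\rangle=D\langle D';\lambda_H\rangle-(-1)^{|D||D'|}D'\langle D;\lambda_H\rangle-\langle[D,D'];\lambda_H\rangle$. Let $\mathbb D$ be a superconnection on $(M,\Omega(M))$, i.e. an $\mathbb R$-bilinear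 map $\mathrm{Der}\,\Omega(M)\times\mathrm{Der}\,\Omega(M)\to\mathrm{Der}\,\Omega(M)$, $\Omega(M)$-linear in the first argument and with $\mathbb D_D(\alpha D')=D(\alpha)D'+(-1)^{|\alpha||D|}\alpha\,\mathbb D_DD'$. Assume that $\mathbb D$ is given by ordinary tensor fields, i.e. for all vector fields $X,Y$ $$\mathbb D_{\nabla_X}\nabla_Y=\nabla_{\nabla_XY+K_0(X,Y)}+i_{L_0(X,Y)},\qquad \mathbb D_{\nabla_X}i_Y=\nabla_{K_1(X,Y)}+i_{\nabla_XY+L_1(X,Y)},$$ $$\mathbb D_{i_X}\nabla_Y=\nabla_{K_2(X,Y)}+i_{L_2(X,Y)},\qquad \mathbb D_{i_X}i_Y=\nabla_{K_3(X,Y)}+i_{L_3(X,Y)},$$ with tensor fields $K_0,K_1,K_2,K_3,L_1,L_2,L_3$ of type $TM\otimes TM\to TM$ and $L_0$ of type $TM\otimes TM\to T^*M\otimes TM$ (where $i_{\alpha\otimes X}=\alpha\, i_X$). Assume that $\mathbb D$ is symmetric, $\mathbb D_DD'-(-1)^{|D||D'|}\mathbb D_{D'}D=[D,D']$, and compatible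 with $\omega$, $D\langle D_1,D_2;\omega\rangle=\langle\mathbb D_DD_1,D_2;\omega\rangle+(-1)^{|D||D_1|}\langle D_1,\mathbb D_DD_2;\omega\rangle$. Let $\mathrm{Curv}(D,D')=[\mathbb D_D,\mathbb D_{D'}]-\mathbb D_{[D,D']}$ and let $\langle D,D';\mathbf{Ric}^{\omega}\rangle$ be the supertrace of $D''\mapsto(-1)^{|D'||D''|}\mathrm{Curv}(D,D'')D'$. For $G\in\{\omega,\mathbf{Ric}^\omega\}$ and homogeneous $D$ let $G^\flat(D)$ be the left $\Omega(M)$-linear form $D'\mapsto(-1)^{|D|\,|\langle D,D';G\rangle|}\langle D,D';G\rangle$ on $\mathrm{Der}\,\Omega(M)$. The supertrace of $\Phi$ is the sum of the diagonal left components of $\Phi$ along the $\nabla_{X_i}$ minus the sum of those along the $i_{X_i}$, computed from any finite family of functions $g_i$ and vector fields $X_i$ on $M$ with $Y=\sum_iY(g_i)X_i$ for every vector field $Y$ (for instance coordinates and coordinate fields on a chart domain; on any $M$ such families come from embeddings in $\mathbb R^N$). Then there is exactly one map $\Phi=(\omega^\flat)^{-1}\circ(\mathbf{Ric}^{\omega})^\flat$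 from homogeneous elements of $\mathrm{Der}\,\Omega(M)$ to $\mathrm{Der}\,\Omega(M)$ with $\omega^\flat\circ\Phi=(\mathbf{Ric}^\omega)^\flat$, and the odd symplectic scalar curvature vanishes identically: $$\mathbf{Scal}^{\omega_H}=\mathrm{STr}\bigl((\omega^\flat)^{-1}\circ(\mathbf{Ric}^{\omega})^\flat\bigr)=0 .$$ -/

import Mathlib

open scoped Manifold ContDiff

noncomputable section

namespace CartanKoszul

/-! ### Vector fields, forms and linear connections

Everything is expressed through the algebra `R` of smooth functions; in the theorem `R` is
`C^∞(M)` for a Hausdorff second countable manifold `M`, for which the derivations of `R` are the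
smooth vector fields, their `R`-dual is the module of smooth one-forms, and the exterior algebra of
the latter over `R` is the algebra of smooth differential forms. -/

/-- Vector fields: the derivations of the algebra of functions. -/
abbrev VF (R : Type*) [CommRing R] [Algebra ℝ R] := Derivation ℝ R R

/-- Differential one-forms. -/
abbrev OneForm (R : Type*) [CommRing R] [Algebra ℝ R] := Module.Dual R (VF R)

/-- The algebra `Ω` of differential forms, i.e. the superfunctions of the Cartan–Koszul
supermanifold. -/
abbrev Forms (R : Type*) [CommRing R] [Algebra ℝ R] := ExteriorAlgebra R (OneForm R)

/-- `ℝ`-linear operators on differential forms, a left `Ω`-module: `(α • f) β = α * f β`. -/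
abbrev Op (R : Type*) [CommRing R] [Algebra ℝ R] := Forms R →ₗ[ℝ] Forms R

variable {R : Type*} [CommRing R] [Algebra ℝ R]

/-- A function seen as a form. -/
abbrev fn (f : R) : Forms R := algebraMap R (Forms R) f

/-- A one-form seen as a form. -/
abbrev form1 (θ : OneForm R) : Forms R := ExteriorAlgebra.ι R θ

/-- The differential `df` of a function, `df(X) = X f`. -/
def dfun (f : R) : OneForm R where
  toFun X := X f
  map_add' _ _ := rfl
  map_smul' _ _ := rfl

/-- Linear (Koszul) connections. -/
structure LinConn (R : Type*) [CommRing R] [Algebra ℝ R] where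
  toFun : VF R →ₗ[R] VF R →ₗ[ℝ] VF R
  leibniz : ∀ (X : VF R) (f : R) (Y : VF R), toFun X (f • Y) = X f • Y + f • toFun X Y

/-- A linear connection is symmetric when its torsion vanishes. -/
def LinConn.IsSymmetric (C : LinConn R) : Prop :=
  ∀ X Y : VF R, C.toFun X Y - C.toFun Y X - ⁅X, Y⁆ = 0

/-- The induced connection on one-forms: `(∇_X θ)(Y) = X (θ Y) - θ (∇_X Y)`. -/
def LinConn.onOneForm (C : LinConn R) (X : VF R) (θ : OneForm R) : OneForm R where
  toFun Y := X (θ Y) - θ (C.toFun X Y)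
  map_add' Y Z := by simp only [map_add]; ring
  map_smul' f Y := by
    simp only [map_smul, C.leibniz, map_add, smul_eq_mul, Derivation.leibniz, RingHom.id_apply]
    ring

/-- `∇ H = 0` for `H : TM → T*M`. -/
def LinConn.Preserves (C : LinConn R) (H : VF R ≃ₗ[R] OneForm R) : Prop :=
  ∀ X Y : VF R, C.onOneForm X (H Y) = H (C.toFun X Y)

/-! ### The covariant derivative of forms -/

/-- The ring homomorphism `f ↦ f + ε X f` into the dual numbers over the forms. -/
def jetHom (X : VF R) : R →+* DualNumber (Forms R) where
  toFun f := TrivSqZeroExt.inl (fn f) + TrivSqZeroExt.inr (fn (X f))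
  map_one' := by ext <;> simp
  map_zero' := by ext <;> simp
  map_add' f g := by
    ext
    · simp only [fn, map_add, TrivSqZeroExt.fst_add, TrivSqZeroExt.fst_inl,
        TrivSqZeroExt.fst_inr, add_zero]
    · simp only [fn, map_add, TrivSqZeroExt.snd_add, TrivSqZeroExt.snd_inl,
        TrivSqZeroExt.snd_inr, zero_add]
  map_mul' f g := by
    ext
    · simp only [fn, map_mul, TrivSqZeroExt.fst_add, TrivSqZeroExt.fst_inl,
        TrivSqZeroExt.fst_inr, add_zero, TrivSqZeroExt.fst_mul]
    · simp only [fn, Derivation.leibniz, smul_eq_mul, map_add, map_mul, TrivSqZeroExt.snd_add,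
        TrivSqZeroExt.fst_add, TrivSqZeroExt.fst_inl, TrivSqZeroExt.fst_inr, TrivSqZeroExt.snd_inl,
        TrivSqZeroExt.snd_inr, add_zero, zero_add, TrivSqZeroExt.snd_mul,
        MulOpposite.smul_eq_mul_unop, MulOpposite.unop_op]
      rw [Algebra.commutes g]

/-- The dual numbers over the forms, to be regarded as an `R`-algebra through `jetHom X`. -/
def JetAlg (_X : VF R) := DualNumber (Forms R)

instance (X : VF R) : Ring (JetAlg X) := inferInstanceAs (Ring (DualNumber (Forms R)))

/-- The identity. -/
def toJet (X : VF R) : DualNumber (Forms R) ≃+* JetAlg X := RingEquiv.refl (DualNumber (Forms R))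

theorem jetHom_central (X : VF R) (f : R) (x : DualNumber (Forms R)) :
    jetHom X f * x = x * jetHom X f := by
  ext
  · simp only [jetHom, RingHom.coe_mk, MonoidHom.coe_mk, OneHom.coe_mk, TrivSqZeroExt.fst_mul,
      TrivSqZeroExt.fst_add, TrivSqZeroExt.fst_inl, TrivSqZeroExt.fst_inr, add_zero]
    exact Algebra.commutes _ _
  · simp only [jetHom, RingHom.coe_mk, MonoidHom.coe_mk, OneHom.coe_mk, TrivSqZeroExt.snd_add,
        TrivSqZeroExt.fst_add, TrivSqZeroExt.fst_inl, TrivSqZeroExt.fst_inr, TrivSqZeroExt.snd_inl,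
        TrivSqZeroExt.snd_inr, add_zero, zero_add, TrivSqZeroExt.snd_mul, smul_eq_mul,
        MulOpposite.smul_eq_mul_unop, MulOpposite.unop_op]
    rw [Algebra.commutes (X f), Algebra.commutes f, add_comm]

instance (X : VF R) : Algebra R (JetAlg X) :=
  RingHom.toAlgebra' ((toJet X : DualNumber (Forms R) →+* JetAlg X).comp (jetHom X)) (by
    intro f x
    obtain ⟨y, rfl⟩ := (toJet X).surjective x
    change toJet X (jetHom X f) * toJet X y = toJet X y * toJet X (jetHom X f)
    rw [← map_mul, ← map_mul, jetHom_central])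

theorem algebraMap_jet (X : VF R) (f : R) :
    algebraMap R (JetAlg X) f = toJet X (jetHom X f) := rfl

theorem LinConn.onOneForm_add (C : LinConn R) (X : VF R) (θ η : OneForm R) :
    C.onOneForm X (θ + η) = C.onOneForm X θ + C.onOneForm X η := by
  ext Y
  change X (θ Y + η Y) - (θ (C.toFun X Y) + η (C.toFun X Y)) =
    (X (θ Y) - θ (C.toFun X Y)) + (X (η Y) - η (C.toFun X Y))
  rw [map_add]; ring

theorem LinConn.onOneForm_smul (C : LinConn R) (X : VF R) (f : R) (θ : OneForm R) :
    C.onOneForm X (f • θ) = X f • θ + f • C.onOneForm X θ := by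
  ext Y
  change X (f * θ Y) - f * θ (C.toFun X Y) = X f * θ Y + f * (X (θ Y) - θ (C.toFun X Y))
  rw [Derivation.leibniz, smul_eq_mul, smul_eq_mul]; ring

/-- `θ ↦ θ + ε ∇_X θ`. -/
def LinConn.jetOne (C : LinConn R) (X : VF R) : OneForm R →ₗ[R] JetAlg X where
  toFun θ := toJet X (TrivSqZeroExt.inl (form1 θ) + TrivSqZeroExt.inr (form1 (C.onOneForm X θ)))
  map_add' θ η := by
    rw [← map_add]
    congr 1
    ext
    · simp only [form1, map_add, TrivSqZeroExt.fst_add, TrivSqZeroExt.fst_inl,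
        TrivSqZeroExt.fst_inr, add_zero]
    · simp only [form1, map_add, C.onOneForm_add, TrivSqZeroExt.snd_add, TrivSqZeroExt.snd_inl,
        TrivSqZeroExt.snd_inr, zero_add]
  map_smul' f θ := by
    rw [RingHom.id_apply, Algebra.smul_def, algebraMap_jet, ← map_mul]
    congr 1
    ext
    · simp only [form1, map_smul, jetHom, RingHom.coe_mk, MonoidHom.coe_mk, OneHom.coe_mk,
        TrivSqZeroExt.fst_mul, TrivSqZeroExt.fst_add, TrivSqZeroExt.fst_inl,
        TrivSqZeroExt.fst_inr, add_zero]
      exact Algebra.smul_def _ _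
    · simp only [form1, C.onOneForm_smul, map_add, map_smul, jetHom, RingHom.coe_mk,
        MonoidHom.coe_mk, OneHom.coe_mk, TrivSqZeroExt.snd_add, TrivSqZeroExt.fst_add,
        TrivSqZeroExt.fst_inl, TrivSqZeroExt.fst_inr, TrivSqZeroExt.snd_inl,
        TrivSqZeroExt.snd_inr, add_zero, zero_add, TrivSqZeroExt.snd_mul, smul_eq_mul,
        MulOpposite.smul_eq_mul_unop, MulOpposite.unop_op]
      rw [Algebra.smul_def, Algebra.smul_def, add_comm]

theorem LinConn.jetOne_sq (C : LinConn R) (X : VF R) (θ : OneForm R) :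
    C.jetOne X θ * C.jetOne X θ = 0 := by
  change toJet X _ * toJet X _ = 0
  rw [← map_mul, ← map_zero (toJet X)]
  congr 1
  ext
  · simp only [TrivSqZeroExt.fst_mul, TrivSqZeroExt.fst_add, TrivSqZeroExt.fst_inl,
      TrivSqZeroExt.fst_inr, add_zero]
    exact ExteriorAlgebra.ι_sq_zero θ
  · simp only [TrivSqZeroExt.snd_add, TrivSqZeroExt.fst_add, TrivSqZeroExt.fst_inl,
      TrivSqZeroExt.fst_inr, TrivSqZeroExt.snd_inl, TrivSqZeroExt.snd_inr, add_zero, zero_add,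
      TrivSqZeroExt.snd_mul, smul_eq_mul, MulOpposite.smul_eq_mul_unop, MulOpposite.unop_op]
    exact ExteriorAlgebra.ι_add_mul_swap _ _

/-- The algebra homomorphism `α ↦ α + ε ∇_X α`. -/
def LinConn.jet (C : LinConn R) (X : VF R) : Forms R →ₐ[R] JetAlg X :=
  ExteriorAlgebra.lift R ⟨C.jetOne X, C.jetOne_sq X⟩

/-- The same, with values in the dual numbers. -/
def LinConn.jetRing (C : LinConn R) (X : VF R) : Forms R →+* DualNumber (Forms R) :=
  ((toJet X).symm : JetAlg X →+* DualNumber (Forms R)).comp (C.jet X : Forms R →+* JetAlg X)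

theorem LinConn.jetRing_fn (C : LinConn R) (X : VF R) (f : R) :
    C.jetRing X (fn f) = jetHom X f := by
  change (toJet X).symm (C.jet X (algebraMap R (Forms R) f)) = _
  rw [AlgHom.commutes, algebraMap_jet, RingEquiv.symm_apply_apply]

theorem LinConn.jetRing_form1 (C : LinConn R) (X : VF R) (θ : OneForm R) :
    C.jetRing X (form1 θ) =
      TrivSqZeroExt.inl (form1 θ) + TrivSqZeroExt.inr (form1 (C.onOneForm X θ)) := by
  change (toJet X).symm (ExteriorAlgebra.lift R _ (ExteriorAlgebra.ι R θ)) = _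
  rw [ExteriorAlgebra.lift_ι_apply]
  exact (toJet X).symm_apply_apply _

theorem LinConn.fst_jetRing (C : LinConn R) (X : VF R) (α : Forms R) :
    TrivSqZeroExt.fst (C.jetRing X α) = α := by
  induction α using ExteriorAlgebra.induction with
  | algebraMap r => rw [C.jetRing_fn]; exact add_zero _
  | ι θ => rw [C.jetRing_form1]; exact add_zero _
  | mul a b ha hb => rw [map_mul, TrivSqZeroExt.fst_mul, ha, hb]
  | add a b ha hb => rw [map_add, TrivSqZeroExt.fst_add, ha, hb]

theorem LinConn.snd_jetRing_mul (C : LinConn R) (X : VF R) (α β : Forms R) :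
    TrivSqZeroExt.snd (C.jetRing X (α * β)) =
      TrivSqZeroExt.snd (C.jetRing X α) * β + α * TrivSqZeroExt.snd (C.jetRing X β) := by
  rw [map_mul, TrivSqZeroExt.snd_mul, C.fst_jetRing, C.fst_jetRing, smul_eq_mul,
    MulOpposite.smul_eq_mul_unop, MulOpposite.unop_op, add_comm]

theorem LinConn.snd_jetRing_fn (C : LinConn R) (X : VF R) (f : R) :
    TrivSqZeroExt.snd (C.jetRing X (fn f)) = fn (X f) := by
  rw [C.jetRing_fn]; exact zero_add _

/-- The covariant derivative `∇_X` on forms: the derivation that extends `f ↦ X f` and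
`θ ↦ ∇_X θ` (see the three lemmas that follow). -/
def LinConn.cov (C : LinConn R) (X : VF R) : Op R where
  toFun α := TrivSqZeroExt.snd (C.jetRing X α)
  map_add' a b := by rw [map_add]; exact TrivSqZeroExt.snd_add _ _
  map_smul' c a := by
    have h : c • a = fn (algebraMap ℝ R c) * a := by
      rw [Algebra.smul_def, IsScalarTower.algebraMap_apply ℝ R (Forms R)]
    rw [h, C.snd_jetRing_mul, C.snd_jetRing_fn, Derivation.map_algebraMap, fn, map_zero, zero_mul,
      zero_add, RingHom.id_apply, Algebra.smul_def, IsScalarTower.algebraMap_apply ℝ R (Forms R)]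

theorem LinConn.cov_fn (C : LinConn R) (X : VF R) (f : R) : C.cov X (fn f) = fn (X f) :=
  C.snd_jetRing_fn X f

theorem LinConn.cov_form1 (C : LinConn R) (X : VF R) (θ : OneForm R) :
    C.cov X (form1 θ) = form1 (C.onOneForm X θ) := by
  change TrivSqZeroExt.snd (C.jetRing X (form1 θ)) = _
  rw [C.jetRing_form1]; exact zero_add _

theorem LinConn.cov_mul (C : LinConn R) (X : VF R) (α β : Forms R) :
    C.cov X (α * β) = C.cov X α * β + α * C.cov X β :=
  C.snd_jetRing_mul X α β

/-- The insertion `i_X` of a vector field. -/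
def ins (X : VF R) : Op R :=
  (CliffordAlgebra.contractLeft (Q := (0 : QuadraticForm R (OneForm R)))
    (Module.Dual.eval R (VF R) X)).restrictScalars ℝ

/-! ### Supervector fields -/

/-- The grading automorphism `α ↦ (-1)^|α| α` of the forms. -/
def grad : Forms R →ₐ[R] Forms R :=
  CliffordAlgebra.involute (Q := (0 : QuadraticForm R (OneForm R)))

/-- `α ↦ (-1)^(p|α|) α`. -/
def tw (p : ZMod 2) : Forms R →ₐ[R] Forms R := grad ^ p.val

/-- The sign `(-1)^(pq)`. -/
def sgn (p q : ZMod 2) : ℤ := (-1) ^ (p.val * q.val)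

/-- `f` is a superderivation of parity `p`: it shifts the `ℤ/2`-degree by `p`, i.e. it commutes with
the grading automorphism up to `(-1)^p`, and `f(αβ) = f(α)β + (-1)^(p|α|) α f(β)`. -/
structure IsSDer (p : ZMod 2) (f : Op R) : Prop where
  parity : ∀ α, grad (f α) = (-1 : ℤ) ^ p.val • f (grad α)
  leibniz : ∀ α β, f (α * β) = f α * β + tw p α * f β

/-- Homogeneous supervector fields of parity `p`. -/
def SDer (R : Type*) [CommRing R] [Algebra ℝ R] (p : ZMod 2) := {f : Op R // IsSDer p f}

/-- The left `Ω`-module `Der Ω` of supervector fields: sums of homogeneous superderivations. -/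
def Der (R : Type*) [CommRing R] [Algebra ℝ R] : Submodule (Forms R) (Op R) :=
  Submodule.span (Forms R) {f | ∃ p, IsSDer p f}

/-- A homogeneous supervector field as an element of `Der Ω`. -/
def SDer.der {p : ZMod 2} (D : SDer R p) : Der R :=
  ⟨D.1, Submodule.subset_span ⟨p, D.2⟩⟩

theorem tw_zero (α : Forms R) : tw 0 α = α := rfl

theorem tw_one (α : Forms R) : tw 1 α = grad α := by
  have h : (1 : ZMod 2).val = 1 := rfl
  rw [tw, h, pow_one]

theorem grad_fn (f : R) : grad (fn f) = fn f := AlgHom.commutes _ _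

theorem grad_form1 (θ : OneForm R) : grad (form1 θ) = -form1 θ :=
  CliffordAlgebra.involute_ι (Q := (0 : QuadraticForm R (OneForm R))) θ

theorem grad_grad (α : Forms R) : grad (grad α) = α :=
  CliffordAlgebra.involute_involute (Q := (0 : QuadraticForm R (OneForm R))) α

theorem LinConn.isSDer_cov (C : LinConn R) (X : VF R) : IsSDer 0 (C.cov X) where
  parity α := by
    have h : (0 : ZMod 2).val = 0 := rfl
    rw [h, pow_zero, one_smul]
    induction α using ExteriorAlgebra.induction with
    | algebraMap r => rw [C.cov_fn, grad_fn, grad_fn, C.cov_fn]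
    | ι θ => rw [C.cov_form1, grad_form1, grad_form1, map_neg, C.cov_form1]
    | mul a b ha hb => rw [C.cov_mul, map_add, map_mul, map_mul, ha, hb, map_mul, C.cov_mul]
    | add a b ha hb => rw [map_add, map_add, ha, hb, map_add, map_add]
  leibniz α β := C.cov_mul X α β

theorem ins_fn (X : VF R) (f : R) : ins X (fn f) = 0 :=
  CliffordAlgebra.contractLeft_algebraMap _ _ _

theorem ins_form1 (X : VF R) (θ : OneForm R) : ins X (form1 θ) = fn (θ X) :=
  CliffordAlgebra.contractLeft_ι _ _ _

theorem ins_mul (X : VF R) (α β : Forms R) :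
    ins X (α * β) = ins X α * β + grad α * ins X β := by
  induction α using ExteriorAlgebra.induction generalizing β with
  | algebraMap r =>
    rw [ins_fn, grad_fn, zero_mul, zero_add]
    exact CliffordAlgebra.contractLeft_algebraMap_mul _ _ _
  | ι θ =>
    rw [ins_form1, grad_form1, neg_mul, ← sub_eq_add_neg, ← Algebra.smul_def]
    exact CliffordAlgebra.contractLeft_ι_mul _ _ _
  | mul a b ha hb =>
    rw [mul_assoc, ha, hb, ha b, map_mul, add_mul, mul_add, mul_assoc, mul_assoc, mul_assoc,
      add_assoc]
  | add a b ha hb => rw [add_mul, map_add, ha, hb, map_add, map_add, add_mul, add_mul]; abel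

theorem isSDer_ins (X : VF R) : IsSDer 1 (ins X) where
  parity α := by
    have h : (1 : ZMod 2).val = 1 := rfl
    rw [h, pow_one, neg_smul, one_smul]
    induction α using ExteriorAlgebra.induction with
    | algebraMap r => rw [ins_fn, grad_fn, ins_fn, map_zero, neg_zero]
    | ι θ => rw [ins_form1, grad_fn, grad_form1, map_neg, neg_neg, ins_form1]
    | mul a b ha hb =>
      rw [ins_mul, map_add, map_mul, map_mul, ha, hb, map_mul, ins_mul]
      noncomm_ring
    | add a b ha hb => rw [map_add, map_add, ha, hb, map_add, map_add, neg_add]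
  leibniz α β := by rw [tw_one]; exact ins_mul X α β

/-- `∇_X` as an even supervector field. -/
def LinConn.covD (C : LinConn R) (X : VF R) : SDer R 0 := ⟨C.cov X, C.isSDer_cov X⟩

/-- `i_X` as an odd supervector field. -/
def insD (X : VF R) : SDer R 1 := ⟨ins X, isSDer_ins X⟩

/-- `f ∘ g - (-1)^(pq) g ∘ f`. -/
def comm (p q : ZMod 2) (f g : Op R) : Op R := f ∘ₗ g - sgn p q • (g ∘ₗ f)

theorem IsSDer.comm {p q : ZMod 2} {f g : Op R} (hf : IsSDer p f) (hg : IsSDer q g) :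
    IsSDer (p + q) (comm p q f g) := by
  have h0 : (0 : ZMod 2).val = 0 := rfl
  have h1 : (1 : ZMod 2).val = 1 := rfl
  have e : (1 : ZMod 2) + 1 = 0 := rfl
  have hfp := hf.parity
  have hgp := hg.parity
  have hfl := hf.leibniz
  have hgl := hg.leibniz
  have hz : ∀ p : ZMod 2, p = 0 ∨ p = 1 := by decide
  rcases hz p with rfl | rfl <;> rcases hz q with rfl | rfl <;>
  constructor <;> intros <;>
  simp only [CartanKoszul.comm, sgn, h0, h1, e, zero_add, add_zero, mul_zero, mul_one,
    pow_zero, pow_one, one_smul, neg_smul, tw_zero, tw_one, LinearMap.sub_apply,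
    LinearMap.comp_apply, LinearMap.neg_apply, map_sub, map_neg] at hfp hgp hfl hgl ⊢ <;>
  simp only [hfp, hgp, hfl, hgl, map_add, map_neg, grad_grad] <;>
  noncomm_ring

/-- The bracket `[D, D'] = D ∘ D' - (-1)^(|D||D'|) D' ∘ D` of supervector fields. -/
def bracket {p q : ZMod 2} (D : SDer R p) (D' : SDer R q) : SDer R (p + q) :=
  ⟨comm p q D.1 D'.1, D.2.comm D'.2⟩

/-! ### Superconnections -/

/-- Superconnections on `(M, Ω(M))`. -/
structure Superconnection (R : Type*) [CommRing R] [Algebra ℝ R] where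
  toFun : Der R →ₗ[Forms R] Der R →ₗ[ℝ] Der R
  leibniz : ∀ (p : ZMod 2) (D : SDer R p) (α : Forms R) (D' : Der R),
    toFun D.der (α • D') = D.1 α • D' + tw p α • toFun D.der D'

/-- The torsion `∇_D D' - (-1)^(|D||D'|) ∇_D' D - [D, D']` vanishes. -/
def Superconnection.IsSymmetric (S : Superconnection R) : Prop :=
  ∀ (p q : ZMod 2) (D : SDer R p) (D' : SDer R q),
    S.toFun D.der D'.der - sgn p q • S.toFun D'.der D.der - (bracket D D').der = 0

/-- The curvature `[∇_D, ∇_D'] D'' - ∇_[D, D'] D''`. -/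
def Superconnection.curv (S : Superconnection R) {p q : ZMod 2} (D : SDer R p) (D' : SDer R q)
    (D'' : Der R) : Der R :=
  S.toFun D.der (S.toFun D'.der D'') - sgn p q • S.toFun D'.der (S.toFun D.der D'')
    - S.toFun (bracket D D').der D''

/-! ### Global coordinates, components of supervector fields -/

/-- Finitely many functions `g i` and vector fields `X i` such that `Y = ∑ Y(g i) X i` for every
vector field `Y`; that is, `(X i)`, `(d g i)` are dual generating systems of the vector fields and
the one-forms. Coordinates `x^i` with `∂/∂x^i` are an example when `M` is the domain of a chart;
in general the coordinates of an embedding of `M` in `ℝ^N` and the tangential projections of the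
`∂/∂x^i` are. -/
structure Frame (R : Type*) [CommRing R] [Algebra ℝ R] (N : ℕ) where
  g : Fin N → R
  X : Fin N → VF R
  expand : ∀ Y : VF R, Y = ∑ i, Y (g i) • X i

/-- The component of `D` along `∇_{X i}`. It is left `Ω`-linear in `D`, takes the value `Y (g i)` at
`∇_Y` and vanishes at `i_Y`. -/
def Frame.compCov {N : ℕ} (F : Frame R N) (i : Fin N) (D : Op R) : Forms R := D (fn (F.g i))

/-- The component of `D` along `i_{X j}`. It is left `Ω`-linear in `D`, vanishes at `∇_Y` and takes
the value `Y (g j)` at `i_Y`. -/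
def Frame.compIns {N : ℕ} (F : Frame R N) (C : LinConn R) (j : Fin N) (D : Op R) : Forms R :=
  D (form1 (dfun (F.g j))) -
    ∑ i, F.compCov i D * C.cov (F.X i) (form1 (dfun (F.g j)))

theorem Frame.compIns_ins {N : ℕ} (F : Frame R N) (C : LinConn R) (j : Fin N) (Y : VF R) :
    F.compIns C j (ins Y) = fn (Y (F.g j)) := by
  rw [Frame.compIns, ins_form1, Finset.sum_eq_zero, sub_zero]
  · rfl
  · intro i _
    rw [Frame.compCov, ins_fn, zero_mul]

theorem Frame.compIns_cov {N : ℕ} (F : Frame R N) (C : LinConn R) (j : Fin N) (Y : VF R) :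
    F.compIns C j (C.cov Y) = 0 := by
  rw [Frame.compIns, sub_eq_zero, C.cov_form1]
  have h : ∀ θ : OneForm R, C.onOneForm Y θ = ∑ i, Y (F.g i) • C.onOneForm (F.X i) θ := by
    intro θ
    ext Z
    have e : ∀ f : R, Y f = ∑ i, Y (F.g i) * F.X i f := by
      intro f
      change dfun f Y = _
      conv_lhs => rw [F.expand Y]
      rw [map_sum]
      exact Finset.sum_congr rfl fun i _ => by rw [map_smul]; rfl
    have e' : C.toFun Y Z = ∑ i, Y (F.g i) • C.toFun (F.X i) Z := by
      conv_lhs => rw [F.expand Y]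
      rw [map_sum, LinearMap.sum_apply]
      exact Finset.sum_congr rfl fun i _ => by rw [map_smul]; rfl
    rw [LinearMap.sum_apply]
    change Y (θ Z) - θ (C.toFun Y Z) =
      ∑ i, Y (F.g i) * (F.X i (θ Z) - θ (C.toFun (F.X i) Z))
    rw [e (θ Z), e', map_sum, ← Finset.sum_sub_distrib]
    exact Finset.sum_congr rfl fun i _ => by rw [map_smul, smul_eq_mul, mul_sub]
  rw [h, form1, map_sum]
  refine Finset.sum_congr rfl fun i _ => ?_
  rw [Frame.compCov, C.cov_fn, C.cov_form1, map_smul, Algebra.smul_def]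

/-- The supertrace of `Φ : Der Ω → Der Ω` (given on homogeneous arguments), from the diagonal
components with respect to the supervector fields `∇_{X i}` and `i_{X i}`. -/
def Frame.supertrace {N : ℕ} (F : Frame R N) (C : LinConn R)
    (Φ : (p : ZMod 2) → SDer R p → Der R) : Forms R :=
  ∑ i, F.compCov i (Φ 0 (C.covD (F.X i))).1 - ∑ i, F.compIns C i (Φ 1 (insD (F.X i))).1

/-- `i_A` for a vector valued one-form, seen as an endomorphism `A` of the module of vector
fields: `A = ∑ (d g j ∘ A) ⊗ X j`, so that `i_A = ∑ (d g j ∘ A) i_{X j}`. -/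
def Frame.insEnd {N : ℕ} (F : Frame R N) (A : VF R →ₗ[R] VF R) : Der R :=
  ∑ j, form1 (dfun (F.g j) ∘ₗ A) • (insD (F.X j)).der

/-! ### The odd symplectic form -/

/-- The component of parity `p` of an operator. -/
def part (p : ZMod 2) (f : Op R) : Op R :=
  (1 / 2 : ℝ) • (f + (-1 : ℤ) ^ p.val •
    ((grad.toLinearMap.restrictScalars ℝ) ∘ₗ f ∘ₗ (grad.toLinearMap.restrictScalars ℝ)))

/-- The odd super one-form `λ_H`: the left `Ω`-linear form with `⟨∇_X; λ_H⟩ = H(X)` and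
`⟨i_X; λ_H⟩ = 0`. -/
def Frame.lam {N : ℕ} (F : Frame R N) (H : VF R ≃ₗ[R] OneForm R) (D : Op R) : Forms R :=
  ∑ i, F.compCov i D * form1 (H (F.X i))

theorem Frame.lam_cov {N : ℕ} (F : Frame R N) (H : VF R ≃ₗ[R] OneForm R) (C : LinConn R)
    (Y : VF R) : F.lam H (C.cov Y) = form1 (H Y) := by
  conv_rhs => rw [F.expand Y]
  rw [map_sum, form1, map_sum]
  refine Finset.sum_congr rfl fun i _ => ?_
  rw [Frame.compCov, C.cov_fn, map_smul, map_smul, Algebra.smul_def]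

theorem Frame.lam_ins {N : ℕ} (F : Frame R N) (H : VF R ≃ₗ[R] OneForm R) (Y : VF R) :
    F.lam H (ins Y) = 0 :=
  Finset.sum_eq_zero fun i _ => by rw [Frame.compCov, ins_fn, zero_mul]

/-- `⟨D, D'; d λ_H⟩` for `D`, `D'` of parity `p`, `q`. -/
def Frame.omegaHom {N : ℕ} (F : Frame R N) (H : VF R ≃ₗ[R] OneForm R) (p q : ZMod 2)
    (D D' : Op R) : Forms R :=
  D (F.lam H D') - sgn p q • D' (F.lam H D) - F.lam H (comm p q D D')

/-- The odd symplectic form `ω_H = d λ_H`, extended biadditively to inhomogeneous arguments. -/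
def Frame.omega {N : ℕ} (F : Frame R N) (H : VF R ≃ₗ[R] OneForm R) (D D' : Op R) : Forms R :=
  ∑ p : ZMod 2, ∑ q : ZMod 2, F.omegaHom H p q (part p D) (part q D')

/-- Compatibility of a superconnection with `ω_H`. -/
def Superconnection.IsCompatible (S : Superconnection R) {N : ℕ} (F : Frame R N)
    (H : VF R ≃ₗ[R] OneForm R) : Prop :=
  ∀ (p q r : ZMod 2) (D : SDer R p) (D₁ : SDer R q) (D₂ : SDer R r),
    D.1 (F.omega H D₁.1 D₂.1) = F.omega H (S.toFun D.der D₁.der).1 D₂.1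
      + sgn p q • F.omega H D₁.1 (S.toFun D.der D₂.der).1

/-- The morphism `ω^♭ : Der Ω → Der* Ω`, evaluated at `D`, `D'`: it is
`(-1)^(|D||⟨D, D'; ω⟩|) ⟨D, D'; ω⟩`, which is left `Ω`-linear in `D'`. -/
def Frame.omegaFlat {N : ℕ} (F : Frame R N) (H : VF R ≃ₗ[R] OneForm R) (D D' : Op R) : Forms R :=
  ∑ p : ZMod 2, tw p (F.omega H (part p D) D')

/-! ### Superconnections given by ordinary tensor fields -/

/-- The superconnection acts on basic supervector fields by
`∇_X, ∇_Y ↦ ∇_(∇_X Y + K₀(X,Y)) + i_(L₀(X,Y))`, `∇_X, i_Y ↦ ∇_(K₁(X,Y)) + i_(∇_X Y + L₁(X,Y))`,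
`i_X, ∇_Y ↦ ∇_(K₂(X,Y)) + i_(L₂(X,Y))`, `i_X, i_Y ↦ ∇_(K₃(X,Y)) + i_(L₃(X,Y))`, where `L₀` takes
values in vector valued one-forms and the other tensors take values in vector fields. -/
structure IsGivenBy {N : ℕ} (F : Frame R N) (C : LinConn R) (S : Superconnection R)
    (K₀ K₁ K₂ K₃ L₁ L₂ L₃ : VF R →ₗ[R] VF R →ₗ[R] VF R)
    (L₀ : VF R →ₗ[R] VF R →ₗ[R] (VF R →ₗ[R] VF R)) : Prop where
  cov_cov : ∀ X Y : VF R, S.toFun (C.covD X).der (C.covD Y).der =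
    (C.covD (C.toFun X Y + K₀ X Y)).der + F.insEnd (L₀ X Y)
  cov_ins : ∀ X Y : VF R, S.toFun (C.covD X).der (insD Y).der =
    (C.covD (K₁ X Y)).der + (insD (C.toFun X Y + L₁ X Y)).der
  ins_cov : ∀ X Y : VF R, S.toFun (insD X).der (C.covD Y).der =
    (C.covD (K₂ X Y)).der + (insD (L₂ X Y)).der
  ins_ins : ∀ X Y : VF R, S.toFun (insD X).der (insD Y).der =
    (C.covD (K₃ X Y)).der + (insD (L₃ X Y)).der

/-! ### Odd Ricci tensor and odd scalar curvature -/

/-- The graded Ricci tensor `⟨D, D'; Ric⟩`: the supertrace of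
`D'' ↦ (-1)^(|D'||D''|) Curv(D, D'') D'`. -/
def ricci {N : ℕ} (F : Frame R N) (C : LinConn R) (S : Superconnection R) {p r : ZMod 2}
    (D : SDer R p) (D' : SDer R r) : Forms R :=
  F.supertrace C fun q D'' => sgn r q • S.curv D D'' D'.der

/-- `Ric^♭`, by the same rule as `ω^♭`. -/
def ricciFlat {N : ℕ} (F : Frame R N) (C : LinConn R) (S : Superconnection R) {p r : ZMod 2}
    (D : SDer R p) (D' : SDer R r) : Forms R :=
  tw p (ricci F C S D D')

/-- `Φ = (ω^♭)⁻¹ ∘ Ric^♭`, that is `ω^♭ ∘ Φ = Ric^♭`. -/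
def IsRicciOperator {N : ℕ} (F : Frame R N) (C : LinConn R) (H : VF R ≃ₗ[R] OneForm R)
    (S : Superconnection R) (Φ : (p : ZMod 2) → SDer R p → Der R) : Prop :=
  ∀ (p r : ZMod 2) (D : SDer R p) (D' : SDer R r),
    F.omegaFlat H (Φ p D).1 D'.1 = ricciFlat F C S D D'

/-! ### Riemannian metrics and symplectic forms -/

/-- `H` comes from a symplectic form `H(X, Y) = H(X)(Y)` (non-degeneracy is the bijectivity of
`H`). -/
def IsSymplectic (H : VF R ≃ₗ[R] OneForm R) : Prop :=
  (∀ X : VF R, H X X = 0) ∧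
  ∀ X Y Z : VF R, X (H Y Z) - Y (H X Z) + Z (H X Y) - H ⁅X, Y⁆ Z + H ⁅X, Z⁆ Y - H ⁅Y, Z⁆ X = 0

/-- `H` comes from a Riemannian metric; a vector field `X` is non-zero at `x` when `(X f) x ≠ 0`
for some function `f`. -/
def IsRiemannian {n : ℕ} {M : Type*} [TopologicalSpace M]
    [ChartedSpace (EuclideanSpace ℝ (Fin n)) M]
    (H : VF C^∞⟮𝓡 n, M; ℝ⟯ ≃ₗ[C^∞⟮𝓡 n, M; ℝ⟯] OneForm C^∞⟮𝓡 n, M; ℝ⟯) : Prop :=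
  (∀ X Y, H X Y = H Y X) ∧
  ∀ (X : VF C^∞⟮𝓡 n, M; ℝ⟯) (x : M), (∃ f : C^∞⟮𝓡 n, M; ℝ⟯, (X f) x ≠ 0) → 0 < (H X X) x

end CartanKoszul

/-!
The odd scalar curvature of a symmetric superconnection compatible with `ω_H` and given by tensor
fields is zero for a reason of linear algebra: it is a sum of full contractions of an antisymmetric
tensor with one that is symmetric in two arguments. The argument works over every commutative
`ℝ`-algebra `R` of functions with a `Frame`, and uses about `H` only that `H(X, Y) = ε H(Y, X)` with
`ε = 1` (metric) or `ε = -1` (symplectic form).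

Supervector fields are generated by the `∇_{X i}` and `i_{X j}` (`Frame.der_eq_sum`). The point that
is not formal is that a superderivation on functions is a combination of the `X i`; it holds
because forms are a direct summand of a free `R`-module, hence are separated by linear functionals.
The form `ω_H` is odd, vanishes on pairs of covariant derivatives (torsion zero and `∇H = 0`) and on
pairs of insertions, and takes the values `∓H` on mixed pairs, so `ω^♭` can be inverted
(`Frame.omegaFlat_injective`, `Frame.exists_omegaFlat_eq`). As `Ric^♭` is left linear
(`ricciFlat_eq_sum`), the Ricci operator exists and is unique, and its supertrace is the contraction
with `H⁻¹` of the mixed components `⟨∇_X, i_Y; Ric⟩` and `⟨i_X, ∇_Y; Ric⟩`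
(`IsRicciOperator.supertrace_eq`).

Symmetry and compatibility force `K₁ = K₂ = 0` and `L₃ = 0`, make `H(K₃(X,Y), Z)` antisymmetric in
all arguments, and make `H(L₀(X,Y) V, Z)` symmetric in `Y` and `Z`. The mixed components of the Ricci
tensor are one-forms, and only the compositions of `K₃` with `L₀` contribute to the supertraces that
define them. After contraction with `H⁻¹`, every term contracts two antisymmetric arguments of `K₃`
with the two symmetric arguments of `L₀` (`Frame.contraction_eq_zero`), so that it vanishes.
-/

namespace CartanKoszul

variable {R : Type*} [CommRing R] [Algebra ℝ R] {N : ℕ}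

/-! ### Signs and parities -/

theorem parity_eq_zero_or_one (p : ZMod 2) : p = 0 ∨ p = 1 := by
  revert p; decide

theorem val_zero_two : (0 : ZMod 2).val = 0 := rfl

theorem val_one_two : (1 : ZMod 2).val = 1 := rfl

theorem sgn_zero_left (q : ZMod 2) : sgn 0 q = 1 := by
  rw [sgn, val_zero_two, zero_mul, pow_zero]

theorem sgn_zero_right (p : ZMod 2) : sgn p 0 = 1 := by
  rw [sgn, val_zero_two, mul_zero, pow_zero]

theorem sgn_one_one : sgn 1 1 = -1 := by
  rw [sgn, val_one_two, mul_one, pow_one]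

theorem sgn_symm (p q : ZMod 2) : sgn p q = sgn q p := by
  rw [sgn, sgn, mul_comm]

theorem sgn_mul_self (p q : ZMod 2) : sgn p q * sgn p q = 1 := by
  rw [sgn, ← mul_pow]; simp

theorem tw_fn (p : ZMod 2) (f : R) : tw p (fn f) = fn f := AlgHom.commutes _ _

theorem tw_tw (p : ZMod 2) (α : Forms R) : tw p (tw p α) = α := by
  rcases parity_eq_zero_or_one p with rfl | rfl
  · rfl
  · rw [tw_one, tw_one, grad_grad]

theorem tw_add_apply (p q : ZMod 2) (α : Forms R) : tw (p + q) α = tw p (tw q α) := by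
  rcases parity_eq_zero_or_one p with rfl | rfl
  · rw [zero_add, tw_zero]
  · rcases parity_eq_zero_or_one q with rfl | rfl
    · rw [add_zero, tw_zero]
    · rw [show (1 : ZMod 2) + 1 = 0 from rfl, tw_zero, tw_one, tw_one, grad_grad]

/-- A form is homogeneous of parity `p` when the grading automorphism acts on it by `(-1)^p`. -/
def IsHomog (p : ZMod 2) (α : Forms R) : Prop := grad α = (-1 : ℤ) ^ p.val • α

theorem isHomog_zero_iff {α : Forms R} : IsHomog 0 α ↔ grad α = α := by
  rw [IsHomog, val_zero_two, pow_zero, one_smul]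

theorem isHomog_one_iff {α : Forms R} : IsHomog 1 α ↔ grad α = -α := by
  rw [IsHomog, val_one_two, pow_one, neg_smul, one_smul]

theorem half_smul_add_self {V : Type*} [AddCommGroup V] [Module ℝ V] (v : V) :
    (1 / 2 : ℝ) • (v + v) = v := by
  rw [← two_smul ℝ v, smul_smul]; norm_num

theorem eq_zero_of_eq_neg_self {V : Type*} [AddCommGroup V] [Module ℝ V] {v : V} (h : v = -v) :
    v = 0 := by
  rw [← half_smul_add_self v, eq_neg_iff_add_eq_zero.1 h, smul_zero]

theorem grad_real_smul (c : ℝ) (α : Forms R) : grad (c • α) = c • grad α :=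
  (grad.toLinearMap.restrictScalars ℝ).map_smul c α

theorem exists_homog_add (α : Forms R) :
    ∃ α₀ α₁, IsHomog 0 α₀ ∧ IsHomog 1 α₁ ∧ α = α₀ + α₁ := by
  refine ⟨(1 / 2 : ℝ) • (α + grad α), (1 / 2 : ℝ) • (α - grad α), ?_, ?_, ?_⟩
  · rw [isHomog_zero_iff, grad_real_smul, map_add, grad_grad, add_comm]
  · rw [isHomog_one_iff, grad_real_smul, map_sub, grad_grad, ← smul_neg, neg_sub]
  · rw [← smul_add, show α + grad α + (α - grad α) = α + α by abel, half_smul_add_self]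

theorem fn_mul_comm (f : R) (α : Forms R) : fn f * α = α * fn f := Algebra.commutes f α

theorem form1_mul (θ : OneForm R) (α : Forms R) : form1 θ * α = grad α * form1 θ := by
  induction α using ExteriorAlgebra.induction with
  | algebraMap r => rw [grad_fn, fn_mul_comm]
  | ι η =>
    have h := ExteriorAlgebra.ι_add_mul_swap (R := R) θ η
    rw [grad_form1, neg_mul]
    exact eq_neg_of_add_eq_zero_left h
  | mul a b ha hb => rw [← mul_assoc, ha, mul_assoc, hb, map_mul, mul_assoc]
  | add a b ha hb => rw [mul_add, map_add, add_mul, ha, hb]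

/-- Graded commutativity of the algebra of forms. -/
theorem IsHomog.mul_comm {p : ZMod 2} {a : Forms R} (ha : IsHomog p a) (α : Forms R) :
    a * α = tw p α * a := by
  induction α using ExteriorAlgebra.induction with
  | algebraMap r => rw [tw_fn, fn_mul_comm]
  | ι θ =>
    have h : a * form1 θ = form1 θ * grad a := by rw [form1_mul, grad_grad]
    rcases parity_eq_zero_or_one p with rfl | rfl
    · rw [tw_zero]; rw [isHomog_zero_iff.1 ha] at h; exact h
    · rw [tw_one, grad_form1, neg_mul, ← mul_neg, ← isHomog_one_iff.1 ha]; exact h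
  | mul b c hb hc => rw [← mul_assoc, hb, mul_assoc, hc, map_mul, mul_assoc]
  | add b c hb hc => rw [mul_add, map_add, add_mul, hb, hc]

theorem IsHomog.tw_eq {p : ZMod 2} {a : Forms R} (ha : IsHomog p a) (q : ZMod 2) :
    tw q a = sgn q p • a := by
  rcases parity_eq_zero_or_one q with rfl | rfl
  · rw [tw_zero, sgn_zero_left, one_smul]
  · rw [tw_one, ha, sgn, val_one_two, one_mul]

theorem smul_op_apply (α β : Forms R) (f : Op R) : (α • f) β = α * f β := rfl

theorem coe_smul_der (α : Forms R) (E : Der R) : (α • E).1 = α • E.1 := rfl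

theorem coe_add_der (E E' : Der R) : (E + E').1 = E.1 + E'.1 := rfl

theorem coe_sum_der {ι : Type*} (s : Finset ι) (E : ι → Der R) :
    (∑ i ∈ s, E i).1 = ∑ i ∈ s, (E i).1 := by
  exact map_sum (Der R).subtype E s

theorem IsHomog.smul_isSDer {s p : ZMod 2} {a : Forms R} (ha : IsHomog s a) {D : Op R}
    (hD : IsSDer p D) : IsSDer (s + p) (a • D) where
  parity α := by
    rw [smul_op_apply, smul_op_apply, map_mul, hD.parity, ha, smul_mul_smul_comm]
    congr 1
    rcases parity_eq_zero_or_one s with rfl | rfl <;>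
    rcases parity_eq_zero_or_one p with rfl | rfl <;> decide
  leibniz α β := by
    rw [smul_op_apply, smul_op_apply, smul_op_apply, hD.leibniz, mul_add, ← mul_assoc,
      ← mul_assoc a (tw p α), ha.mul_comm (tw p α), tw_add_apply, mul_assoc (tw s _)]

theorem IsSDer.add {p : ZMod 2} {D D' : Op R} (hD : IsSDer p D) (hD' : IsSDer p D') :
    IsSDer p (D + D') where
  parity α := by rw [LinearMap.add_apply, LinearMap.add_apply, map_add, hD.parity, hD'.parity,
    smul_add]
  leibniz α β := by
    simp only [LinearMap.add_apply, hD.leibniz, hD'.leibniz, add_mul, mul_add]; abel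

theorem isSDer_zero (p : ZMod 2) : IsSDer p (0 : Op R) where
  parity α := by simp
  leibniz α β := by simp

/-- Every supervector field is the sum of an even and an odd one. -/
theorem exists_sder_add (E : Der R) : ∃ (D₀ : SDer R 0) (D₁ : SDer R 1), E = D₀.der + D₁.der := by
  suffices h : ∃ D₀ D₁ : Op R, IsSDer 0 D₀ ∧ IsSDer 1 D₁ ∧ E.1 = D₀ + D₁ by
    obtain ⟨D₀, D₁, h₀, h₁, h⟩ := h
    exact ⟨⟨D₀, h₀⟩, ⟨D₁, h₁⟩, Subtype.ext h⟩
  obtain ⟨E, hE⟩ := E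
  induction hE using Submodule.span_induction with
  | mem D h =>
    obtain ⟨p, hp⟩ := h
    rcases parity_eq_zero_or_one p with rfl | rfl
    · exact ⟨D, 0, hp, isSDer_zero 1, (add_zero D).symm⟩
    · exact ⟨0, D, isSDer_zero 0, hp, (zero_add D).symm⟩
  | zero => exact ⟨0, 0, isSDer_zero 0, isSDer_zero 1, (add_zero 0).symm⟩
  | add D D' _ _ h h' =>
    obtain ⟨D₀, D₁, h₀, h₁, h⟩ := h
    obtain ⟨D₀', D₁', h₀', h₁', h'⟩ := h'
    refine ⟨D₀ + D₀', D₁ + D₁', h₀.add h₀', h₁.add h₁', ?_⟩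
    change D = _ at h
    change D' = _ at h'
    change D + D' = _
    rw [h, h']; abel
  | smul a D _ h =>
    obtain ⟨D₀, D₁, h₀, h₁, h⟩ := h
    obtain ⟨a₀, a₁, ha₀, ha₁, ha⟩ := exists_homog_add a
    refine ⟨a₀ • D₀ + a₁ • D₁, a₀ • D₁ + a₁ • D₀, (ha₀.smul_isSDer h₀).add (ha₁.smul_isSDer h₁),
      (ha₀.smul_isSDer h₁).add (ha₁.smul_isSDer h₀), ?_⟩
    change D = _ at h
    change a • D = _
    rw [h, ha, add_smul, smul_add, smul_add]; abel

/-! ### Generation of the supervector fields by covariant derivatives and insertions -/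

theorem fn_injective : Function.Injective (fn : R → Forms R) :=
  (ExteriorAlgebra.algebraMap_leftInverse (OneForm R)).injective

theorem fn_sum {ι : Type*} (s : Finset ι) (f : ι → R) : fn (∑ i ∈ s, f i) = ∑ i ∈ s, fn (f i) :=
  map_sum _ _ _

theorem Frame.apply_eq_sum (F : Frame R N) (Y : VF R) (f : R) :
    Y f = ∑ i, Y (F.g i) * F.X i f := by
  change dfun f Y = _
  conv_lhs => rw [F.expand Y]
  rw [map_sum]
  exact Finset.sum_congr rfl fun i _ => by rw [map_smul]; rfl

theorem Frame.oneForm_eq_sum (F : Frame R N) (θ : OneForm R) :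
    θ = ∑ i, θ (F.X i) • dfun (F.g i) := by
  ext Y
  conv_lhs => rw [F.expand Y]
  rw [map_sum, LinearMap.sum_apply]
  refine Finset.sum_congr rfl fun i _ => ?_
  rw [map_smul, LinearMap.smul_apply, smul_eq_mul, smul_eq_mul, mul_comm]
  rfl

/-- Forms are separated by the linear functionals: the one-forms are a direct summand of `R^N`, so
that the forms are a direct summand of a free module. -/
theorem Frame.form_ext (F : Frame R N) {α β : Forms R}
    (h : ∀ φ : Forms R →ₗ[R] R, φ α = φ β) : α = β := by
  let s : OneForm R →ₗ[R] (Fin N → R) := LinearMap.pi fun i => LinearMap.applyₗ (F.X i)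
  let r : (Fin N → R) →ₗ[R] OneForm R :=
    Fintype.linearCombination R fun i => dfun (F.g i)
  have hrs : Function.LeftInverse r s := fun θ => (F.oneForm_eq_sum θ).symm
  apply (ExteriorAlgebra.leftInverse_map_iff.2 hrs).injective
  apply (Pi.basisFun R (Fin N)).ExteriorAlgebra.ext_elem
  intro i
  exact h (((Pi.basisFun R (Fin N)).ExteriorAlgebra.coord i) ∘ₗ (ExteriorAlgebra.map s).toLinearMap)

theorem IsSDer.apply_fn_mul {p : ZMod 2} {D : Op R} (hD : IsSDer p D) (f : R) (α : Forms R) :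
    D (fn f * α) = D (fn f) * α + fn f * D α := by
  rw [hD.leibniz, tw_fn]

/-- The functions are differentiated through the `g i`. Composing with a linear functional on forms
turns the restriction to functions of a superderivation into a vector field. -/
theorem Frame.sder_fn (F : Frame R N) {p : ZMod 2} {D : Op R} (hD : IsSDer p D) (f : R) :
    D (fn f) = ∑ i, F.compCov i D * fn (F.X i f) := by
  refine F.form_ext fun φ => ?_
  let Y : VF R := Derivation.mk'
    ((φ.restrictScalars ℝ) ∘ₗ D ∘ₗ
      ((Algebra.linearMap R (Forms R)).restrictScalars ℝ)) (by
    intro a b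
    change φ (D (fn (a * b))) = a • φ (D (fn b)) + b • φ (D (fn a))
    rw [fn, map_mul, hD.apply_fn_mul, map_add, add_comm, ← fn_mul_comm, ← Algebra.smul_def,
      ← Algebra.smul_def, map_smul, map_smul])
  have h := F.apply_eq_sum Y f
  change φ (D (fn f)) = ∑ i, φ (D (fn (F.g i))) * F.X i f at h
  rw [h, map_sum]
  refine Finset.sum_congr rfl fun i _ => ?_
  rw [Frame.compCov, ← fn_mul_comm, ← Algebra.smul_def, map_smul, smul_eq_mul, mul_comm]

theorem IsSDer.homog_fn {p : ZMod 2} {D : Op R} (hD : IsSDer p D) (f : R) :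
    IsHomog p (D (fn f)) := by
  rw [IsHomog, hD.parity, grad_fn]

theorem Frame.homog_compCov (F : Frame R N) (i : Fin N) {p : ZMod 2} {D : Op R}
    (hD : IsSDer p D) : IsHomog p (F.compCov i D) := hD.homog_fn _

theorem Frame.homog_compIns (F : Frame R N) (C : LinConn R) (i : Fin N) {p : ZMod 2} {D : Op R}
    (hD : IsSDer p D) : IsHomog (p + 1) (F.compIns C i D) := by
  have h : ∀ z : ZMod 2, (-1 : ℤ) ^ (z + 1).val = -(-1 : ℤ) ^ z.val := by decide
  rw [IsHomog, h, Frame.compIns, map_sub, map_sum, hD.parity, grad_form1, map_neg, neg_smul,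
    smul_sub, neg_sub, smul_neg, Finset.smul_sum, sub_eq_neg_add, sub_eq_add_neg,
    ← Finset.sum_neg_distrib, add_comm]
  rw [add_comm]
  congr 1
  refine Finset.sum_congr rfl fun j _ => ?_
  rw [map_mul, F.homog_compCov j hD, C.cov_form1, grad_form1, mul_neg, neg_neg, smul_mul_assoc]

/-- An operator that obeys a Leibniz rule and vanishes on functions and one-forms is zero. -/
theorem op_eq_zero {p : ZMod 2} {D : Op R} (hD : ∀ α β, D (α * β) = D α * β + tw p α * D β)
    (h₀ : ∀ f, D (fn f) = 0) (h₁ : ∀ θ, D (form1 θ) = 0) : D = 0 := by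
  ext α
  rw [LinearMap.zero_apply]
  induction α using ExteriorAlgebra.induction with
  | algebraMap r => exact h₀ r
  | ι θ => exact h₁ θ
  | mul a b ha hb => rw [hD, ha, hb, zero_mul, mul_zero, add_zero]
  | add a b ha hb => rw [map_add, ha, hb, add_zero]

theorem isSDer_finset_sum {ι : Type*} (s : Finset ι) {p : ZMod 2} {D : ι → Op R}
    (hD : ∀ i, IsSDer p (D i)) : IsSDer p (∑ i ∈ s, D i) := by
  classical
  induction s using Finset.induction_on with
  | empty => rw [Finset.sum_empty]; exact isSDer_zero p
  | insert a s ha ih => rw [Finset.sum_insert ha]; exact (hD a).add ih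

theorem IsSDer.sub_leibniz {p : ZMod 2} {D D' : Op R} (hD : IsSDer p D) (hD' : IsSDer p D')
    (α β : Forms R) : (D - D') (α * β) = (D - D') α * β + tw p α * (D - D') β := by
  simp only [LinearMap.sub_apply, hD.leibniz, hD'.leibniz, sub_mul, mul_sub]; abel

theorem Frame.sder_eq_sum (F : Frame R N) (C : LinConn R) {p : ZMod 2} {D : Op R}
    (hD : IsSDer p D) :
    D = ∑ i, F.compCov i D • C.cov (F.X i) + ∑ j, F.compIns C j D • ins (F.X j) := by
  set A : Op R := ∑ i, F.compCov i D • C.cov (F.X i) with hA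
  set B : Op R := ∑ j, F.compIns C j D • ins (F.X j) with hB
  have hA' : IsSDer p A := isSDer_finset_sum _ fun i => by
    simpa using (F.homog_compCov i hD).smul_isSDer (C.isSDer_cov (F.X i))
  have hB' : IsSDer p B := isSDer_finset_sum _ fun i => by
    have h := (F.homog_compIns C i hD).smul_isSDer (isSDer_ins (F.X i))
    rwa [add_assoc, show (1 : ZMod 2) + 1 = 0 from rfl, add_zero] at h
  -- `D - A` is linear over the functions, so it is determined by its values at the `d g j`
  have hf : ∀ f, (D - A) (fn f) = 0 := fun f => by
    rw [LinearMap.sub_apply, F.sder_fn hD, hA, LinearMap.sum_apply, sub_eq_zero]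
    exact Finset.sum_congr rfl fun i _ => by rw [smul_op_apply, C.cov_fn]
  have hg : ∀ j, (D - A) (form1 (dfun (F.g j))) = F.compIns C j D := fun j => by
    rw [LinearMap.sub_apply, hA, LinearMap.sum_apply]; rfl
  have hθ : ∀ θ, (D - A) (form1 θ) = B (form1 θ) := fun θ => by
    conv_lhs => rw [F.oneForm_eq_sum θ]
    rw [form1, map_sum, map_sum, hB, LinearMap.sum_apply]
    refine Finset.sum_congr rfl fun j _ => ?_
    rw [map_smul, Algebra.smul_def, hD.sub_leibniz hA', hf, zero_mul, zero_add, tw_fn,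
      smul_op_apply, ins_form1, hg, fn_mul_comm]
  have h : D - (A + B) = 0 := by
    refine op_eq_zero (hD.sub_leibniz (hA'.add hB')) (fun f => ?_) fun θ => ?_
    · rw [← sub_sub, LinearMap.sub_apply, hf, hB, LinearMap.sum_apply, Finset.sum_eq_zero, sub_zero]
      intro j _
      rw [smul_op_apply, ins_fn, mul_zero]
    · rw [← sub_sub, LinearMap.sub_apply, hθ, sub_self]
  exact sub_eq_zero.1 h

theorem Frame.compCov_add (F : Frame R N) (i : Fin N) (D D' : Op R) :
    F.compCov i (D + D') = F.compCov i D + F.compCov i D' := rfl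

theorem Frame.compCov_smul (F : Frame R N) (i : Fin N) (α : Forms R) (D : Op R) :
    F.compCov i (α • D) = α * F.compCov i D := rfl

theorem Frame.compIns_add (F : Frame R N) (C : LinConn R) (i : Fin N) (D D' : Op R) :
    F.compIns C i (D + D') = F.compIns C i D + F.compIns C i D' := by
  simp only [Frame.compIns, Frame.compCov_add, add_mul, Finset.sum_add_distrib,
    LinearMap.add_apply]
  abel

theorem Frame.compIns_smul (F : Frame R N) (C : LinConn R) (i : Fin N) (α : Forms R) (D : Op R) :
    F.compIns C i (α • D) = α * F.compIns C i D := by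
  simp only [Frame.compIns, Frame.compCov_smul, smul_op_apply, mul_sub, Finset.mul_sum, mul_assoc]

/-- The component along `i_{X j}` as a linear form on all operators. -/
def Frame.compInsLin (F : Frame R N) (C : LinConn R) (i : Fin N) : Op R →ₗ[Forms R] Forms R where
  toFun := F.compIns C i
  map_add' := F.compIns_add C i
  map_smul' := F.compIns_smul C i

theorem Frame.compIns_sub (F : Frame R N) (C : LinConn R) (i : Fin N) (D D' : Op R) :
    F.compIns C i (D - D') = F.compIns C i D - F.compIns C i D' :=
  map_sub (F.compInsLin C i) D D'

theorem Frame.compIns_sum (F : Frame R N) (C : LinConn R) (i : Fin N) {ι : Type*} (s : Finset ι)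
    (D : ι → Op R) : F.compIns C i (∑ j ∈ s, D j) = ∑ j ∈ s, F.compIns C i (D j) :=
  map_sum (F.compInsLin C i) D s

theorem Frame.compCov_sum (F : Frame R N) (i : Fin N) {ι : Type*} (s : Finset ι)
    (D : ι → Op R) : F.compCov i (∑ j ∈ s, D j) = ∑ j ∈ s, F.compCov i (D j) :=
  LinearMap.sum_apply _ _ _

/-- The supervector fields `∇_{X i}` and `i_{X j}` generate the module of supervector fields. -/
theorem Frame.der_eq_sum (F : Frame R N) (C : LinConn R) (E : Der R) :
    E = ∑ i, F.compCov i E.1 • (C.covD (F.X i)).der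
      + ∑ j, F.compIns C j E.1 • (insD (F.X j)).der := by
  obtain ⟨D₀, D₁, rfl⟩ := exists_sder_add E
  apply Subtype.ext
  simp only [coe_add_der, coe_sum_der, coe_smul_der, F.compCov_add, F.compIns_add, add_smul,
    Finset.sum_add_distrib]
  have h₀ := F.sder_eq_sum C D₀.2
  have h₁ := F.sder_eq_sum C D₁.2
  calc D₀.1 + D₁.1 = _ := congrArg₂ (· + ·) h₀ h₁
    _ = _ := by
      simp only [SDer.der, LinConn.covD, insD]
      abel

theorem Frame.sum_compCov_mul (F : Frame R N) (E : Der R) (f : R) :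
    ∑ i, F.compCov i E.1 * fn (F.X i f) = E.1 (fn f) := by
  obtain ⟨D₀, D₁, rfl⟩ := exists_sder_add E
  simp only [coe_add_der, F.compCov_add, add_mul, Finset.sum_add_distrib, LinearMap.add_apply]
  exact congrArg₂ (· + ·) (F.sder_fn D₀.2 f).symm (F.sder_fn D₁.2 f).symm

theorem Frame.sum_compIns_mul (F : Frame R N) (C : LinConn R) (E : Der R) (k : Fin N) :
    ∑ j, F.compIns C j E.1 * fn (F.X j (F.g k)) = F.compIns C k E.1 := by
  conv_rhs => rw [F.der_eq_sum C E]
  simp only [coe_add_der, coe_sum_der, coe_smul_der, F.compIns_add, F.compIns_sum, F.compIns_smul,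
    SDer.der, LinConn.covD, insD, F.compIns_cov, F.compIns_ins, mul_zero, Finset.sum_const_zero,
    zero_add]

/-! ### The odd symplectic form -/

theorem part_add (p : ZMod 2) (D D' : Op R) : part p (D + D') = part p D + part p D' := by
  simp only [part, LinearMap.add_comp, LinearMap.comp_add, smul_add]
  abel

theorem IsSDer.part_self {p : ZMod 2} {D : Op R} (hD : IsSDer p D) : part p D = D := by
  ext α
  change (1 / 2 : ℝ) • (D α + (-1 : ℤ) ^ p.val • grad (D (grad α))) = D α
  rw [hD.parity, grad_grad, smul_smul, ← mul_pow, neg_one_mul, neg_neg, one_pow, one_smul,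
    half_smul_add_self]

theorem IsSDer.part_of_ne {p q : ZMod 2} (h : q ≠ p) {D : Op R} (hD : IsSDer p D) :
    part q D = 0 := by
  ext α
  change (1 / 2 : ℝ) • (D α + (-1 : ℤ) ^ q.val • grad (D (grad α))) = 0
  have e : ∀ q p : ZMod 2, q ≠ p → (-1 : ℤ) ^ q.val * (-1 : ℤ) ^ p.val = -1 := by decide
  rw [hD.parity, grad_grad, smul_smul, e q p h, neg_smul, one_smul, add_neg_cancel, smul_zero]

theorem Frame.lam_add (F : Frame R N) (H : VF R ≃ₗ[R] OneForm R) (D D' : Op R) :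
    F.lam H (D + D') = F.lam H D + F.lam H D' := by
  simp only [Frame.lam, F.compCov_add, add_mul, Finset.sum_add_distrib]

theorem Frame.lam_smul (F : Frame R N) (H : VF R ≃ₗ[R] OneForm R) (α : Forms R) (D : Op R) :
    F.lam H (α • D) = α * F.lam H D := by
  simp only [Frame.lam, F.compCov_smul, mul_assoc, Finset.mul_sum]

/-- `λ_H` as a linear form on all operators. -/
def Frame.lamLin (F : Frame R N) (H : VF R ≃ₗ[R] OneForm R) : Op R →ₗ[Forms R] Forms R where
  toFun := F.lam H
  map_add' := F.lam_add H
  map_smul' := F.lam_smul H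

theorem Frame.lam_sub (F : Frame R N) (H : VF R ≃ₗ[R] OneForm R) (D D' : Op R) :
    F.lam H (D - D') = F.lam H D - F.lam H D' :=
  map_sub (F.lamLin H) D D'

theorem Frame.lam_zsmul (F : Frame R N) (H : VF R ≃ₗ[R] OneForm R) (c : ℤ) (D : Op R) :
    F.lam H (c • D) = c • F.lam H D :=
  map_zsmul (F.lamLin H) c D

theorem comm_swap (p q : ZMod 2) (D D' : Op R) :
    comm p q D D' = -(sgn p q • comm q p D' D) := by
  rw [comm, comm, smul_sub, smul_smul, sgn_symm q p, sgn_mul_self, one_smul, neg_sub]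

theorem Frame.omegaHom_swap (F : Frame R N) (H : VF R ≃ₗ[R] OneForm R) (p q : ZMod 2)
    (D D' : Op R) : F.omegaHom H p q D D' = -(sgn p q • F.omegaHom H q p D' D) := by
  rw [Frame.omegaHom, Frame.omegaHom, comm_swap, ← neg_smul, F.lam_zsmul, smul_sub, smul_sub,
    smul_smul, sgn_symm q p, sgn_mul_self, one_smul, neg_smul]
  abel

theorem Frame.omegaHom_add_left (F : Frame R N) (H : VF R ≃ₗ[R] OneForm R) (p q : ZMod 2)
    (D₁ D₂ D' : Op R) :
    F.omegaHom H p q (D₁ + D₂) D' = F.omegaHom H p q D₁ D' + F.omegaHom H p q D₂ D' := by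
  have e : comm p q (D₁ + D₂) D' = comm p q D₁ D' + comm p q D₂ D' := by
    simp only [comm, LinearMap.add_comp, LinearMap.comp_add, smul_add]; abel
  rw [Frame.omegaHom, e, F.lam_add, F.lam_add, map_add, LinearMap.add_apply, smul_add,
    Frame.omegaHom, Frame.omegaHom]
  abel

theorem Frame.omegaHom_add_right (F : Frame R N) (H : VF R ≃ₗ[R] OneForm R) (p q : ZMod 2)
    (D D₁ D₂ : Op R) :
    F.omegaHom H p q D (D₁ + D₂) = F.omegaHom H p q D D₁ + F.omegaHom H p q D D₂ := by
  rw [F.omegaHom_swap, F.omegaHom_add_left, smul_add, neg_add, ← F.omegaHom_swap,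
    ← F.omegaHom_swap]

theorem Frame.omega_add_left (F : Frame R N) (H : VF R ≃ₗ[R] OneForm R) (D₁ D₂ D' : Op R) :
    F.omega H (D₁ + D₂) D' = F.omega H D₁ D' + F.omega H D₂ D' := by
  simp only [Frame.omega, part_add, F.omegaHom_add_left, Finset.sum_add_distrib]

theorem Frame.omega_add_right (F : Frame R N) (H : VF R ≃ₗ[R] OneForm R) (D D₁ D₂ : Op R) :
    F.omega H D (D₁ + D₂) = F.omega H D D₁ + F.omega H D D₂ := by
  simp only [Frame.omega, part_add, F.omegaHom_add_right, Finset.sum_add_distrib]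

theorem Frame.omega_sum_left (F : Frame R N) (H : VF R ≃ₗ[R] OneForm R) {ι : Type*}
    (s : Finset ι) (D : ι → Op R) (D' : Op R) :
    F.omega H (∑ i ∈ s, D i) D' = ∑ i ∈ s, F.omega H (D i) D' :=
  map_sum (AddMonoidHom.mk' (fun D => F.omega H D D') fun D₁ D₂ => F.omega_add_left H D₁ D₂ D') D s

theorem Frame.omega_sum_right (F : Frame R N) (H : VF R ≃ₗ[R] OneForm R) {ι : Type*}
    (s : Finset ι) (D : Op R) (D' : ι → Op R) :
    F.omega H D (∑ i ∈ s, D' i) = ∑ i ∈ s, F.omega H D (D' i) :=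
  map_sum (AddMonoidHom.mk' (F.omega H D) (F.omega_add_right H D)) D' s

theorem Frame.omega_eq_omegaHom (F : Frame R N) (H : VF R ≃ₗ[R] OneForm R) {p q : ZMod 2}
    {D D' : Op R} (hD : IsSDer p D) (hD' : IsSDer q D') :
    F.omega H D D' = F.omegaHom H p q D D' := by
  have h₁ : ∀ r s E, F.omegaHom H r s 0 E = 0 := fun r s E => by
    simpa using F.omegaHom_add_left H r s 0 0 E
  have h₂ : ∀ r s E, F.omegaHom H r s E 0 = 0 := fun r s E => by
    simpa using F.omegaHom_add_right H r s E 0 0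
  rw [Frame.omega, Finset.sum_eq_single p, Finset.sum_eq_single q, hD.part_self, hD'.part_self]
  · intro s _ hs
    rw [hD'.part_of_ne hs, h₂]
  · exact fun h => absurd (Finset.mem_univ _) h
  · intro r _ hr
    exact Finset.sum_eq_zero fun s _ => by rw [hD.part_of_ne hr, h₁]
  · exact fun h => absurd (Finset.mem_univ _) h

theorem IsHomog.isHomog_sgn {s : ZMod 2} {a : Forms R} (ha : IsHomog s a) (q : ZMod 2)
    (x : Forms R) : tw q a * x = sgn s q • (a * x) := by
  rw [ha.tw_eq, smul_mul_assoc, sgn_symm]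

theorem sgn_add_left (s p q : ZMod 2) : sgn (s + p) q = sgn s q * sgn p q := by
  revert s p q; decide

theorem Frame.omegaHom_smul_left (F : Frame R N) (H : VF R ≃ₗ[R] OneForm R) {s p q : ZMod 2}
    {a : Forms R} (ha : IsHomog s a) (D : Op R) {D' : Op R} (hD' : IsSDer q D') :
    F.omegaHom H (s + p) q (a • D) D' = a * F.omegaHom H p q D D' := by
  have hc : comm (s + p) q (a • D) D' = a • comm p q D D' - sgn (s + p) q • (D' a • D) := by
    ext β
    simp only [comm, LinearMap.sub_apply, LinearMap.smul_apply, LinearMap.comp_apply,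
      smul_eq_mul, hD'.leibniz, ha.isHomog_sgn, smul_add, smul_smul, mul_sub, mul_smul_comm]
    rw [sgn_add_left, mul_right_comm, sgn_mul_self, one_mul]
    abel
  rw [Frame.omegaHom, hc, F.lam_sub, F.lam_zsmul, F.lam_smul, F.lam_smul, F.lam_smul,
    hD'.leibniz, ha.isHomog_sgn, smul_add, smul_smul, sgn_add_left, mul_right_comm, sgn_mul_self,
    one_mul, smul_op_apply, Frame.omegaHom, mul_sub, mul_sub, mul_smul_comm]
  abel

/-- `ω_H` is left linear in its first argument. -/
theorem Frame.omega_smul_left (F : Frame R N) (H : VF R ≃ₗ[R] OneForm R) (α : Forms R)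
    {p q : ZMod 2} {D D' : Op R} (hD : IsSDer p D) (hD' : IsSDer q D') :
    F.omega H (α • D) D' = α * F.omega H D D' := by
  obtain ⟨a, b, ha, hb, rfl⟩ := exists_homog_add α
  rw [add_smul, F.omega_add_left, F.omega_eq_omegaHom H (ha.smul_isSDer hD) hD',
    F.omega_eq_omegaHom H (hb.smul_isSDer hD) hD', F.omegaHom_smul_left H ha _ hD',
    F.omegaHom_smul_left H hb _ hD', F.omega_eq_omegaHom H hD hD', add_mul]

/-- `ω_H` is linear in its second argument up to the sign of moving the coefficient past the
first one. -/
theorem Frame.omega_smul_right (F : Frame R N) (H : VF R ≃ₗ[R] OneForm R) (α : Forms R)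
    {p q : ZMod 2} {D D' : Op R} (hD : IsSDer p D) (hD' : IsSDer q D') :
    F.omega H D (α • D') = tw p α * F.omega H D D' := by
  have key : ∀ {s : ZMod 2} {a : Forms R}, IsHomog s a →
      F.omega H D (a • D') = tw p a * F.omega H D D' := by
    intro s a ha
    rw [F.omega_eq_omegaHom H hD (ha.smul_isSDer hD'), F.omegaHom_swap,
      F.omegaHom_smul_left H ha _ hD, F.omega_eq_omegaHom H hD hD', F.omegaHom_swap H p q,
      ha.isHomog_sgn, mul_neg, smul_neg, mul_smul_comm, smul_smul, sgn_symm p, sgn_add_left,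
      sgn_symm q p]
  obtain ⟨a, b, ha, hb, rfl⟩ := exists_homog_add α
  rw [add_smul, F.omega_add_right, key ha, key hb, map_add, add_mul]

/-- `λ_H(E)` depends only on the action of `E` on functions. -/
theorem Frame.lam_of_fn (F : Frame R N) (H : VF R ≃ₗ[R] OneForm R) {E : Op R} {Y : VF R}
    (h : ∀ f, E (fn f) = fn (Y f)) : F.lam H E = form1 (H Y) := by
  conv_rhs => rw [F.expand Y]
  rw [map_sum, form1, map_sum]
  refine Finset.sum_congr rfl fun i _ => ?_
  rw [Frame.compCov, h, map_smul, map_smul, Algebra.smul_def]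

theorem Frame.omega_ins_ins (F : Frame R N) (H : VF R ≃ₗ[R] OneForm R) (X Y : VF R) :
    F.omega H (ins X) (ins Y) = 0 := by
  rw [F.omega_eq_omegaHom H (isSDer_ins X) (isSDer_ins Y), Frame.omegaHom, F.lam_ins, F.lam_ins,
    map_zero, map_zero, F.lam_of_fn (Y := 0), map_zero, form1, map_zero]
  · simp
  · intro f
    simp only [comm, LinearMap.sub_apply, LinearMap.smul_apply, LinearMap.comp_apply, ins_fn,
      map_zero, smul_zero, sub_zero, Derivation.zero_apply]

theorem Frame.omega_cov_ins (F : Frame R N) (H : VF R ≃ₗ[R] OneForm R) (C : LinConn R)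
    (X Y : VF R) : F.omega H (C.cov X) (ins Y) = -fn (H X Y) := by
  rw [F.omega_eq_omegaHom H (C.isSDer_cov X) (isSDer_ins Y), Frame.omegaHom, F.lam_ins, F.lam_cov,
    map_zero, ins_form1, F.lam_of_fn (Y := 0), map_zero, form1, map_zero, sgn_zero_left]
  · simp
  · intro f
    simp only [comm, LinearMap.sub_apply, LinearMap.smul_apply, LinearMap.comp_apply, ins_fn,
      C.cov_fn, map_zero, smul_zero, sub_zero, Derivation.zero_apply]

theorem Frame.omega_ins_cov (F : Frame R N) (H : VF R ≃ₗ[R] OneForm R) (C : LinConn R)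
    (X Y : VF R) : F.omega H (ins X) (C.cov Y) = fn (H Y X) := by
  rw [F.omega_eq_omegaHom H (isSDer_ins X) (C.isSDer_cov Y), F.omegaHom_swap,
    ← F.omega_eq_omegaHom H (C.isSDer_cov Y) (isSDer_ins X), F.omega_cov_ins, sgn_zero_right,
    one_smul, neg_neg]

theorem Frame.omega_cov_cov (F : Frame R N) (H : VF R ≃ₗ[R] OneForm R) {C : LinConn R}
    (hC : C.IsSymmetric) (hCH : C.Preserves H) (X Y : VF R) :
    F.omega H (C.cov X) (C.cov Y) = 0 := by
  have h : F.lam H (comm 0 0 (C.cov X) (C.cov Y)) = form1 (H ⁅X, Y⁆) := by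
    apply F.lam_of_fn
    intro f
    simp only [comm, LinearMap.sub_apply, LinearMap.comp_apply, C.cov_fn, sgn_zero_left, one_smul, Derivation.commutator_apply, map_sub]
  rw [F.omega_eq_omegaHom H (C.isSDer_cov X) (C.isSDer_cov Y), Frame.omegaHom, h, F.lam_cov,
    F.lam_cov, C.cov_form1, C.cov_form1, hCH, hCH, sgn_zero_left, one_smul, ← map_sub, ← map_sub,
    ← map_sub, ← map_sub, hC X Y, map_zero, map_zero]

/-- The value of `ω_H` at `D`, `i_Z` in terms of the components of `D`. -/
theorem Frame.omega_der_ins (F : Frame R N) (H : VF R ≃ₗ[R] OneForm R) (C : LinConn R)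
    (E : Der R) (Z : VF R) :
    F.omega H E.1 (ins Z) = -∑ i, F.compCov i E.1 * fn (H (F.X i) Z) := by
  conv_lhs => rw [F.der_eq_sum C E]
  rw [coe_add_der, coe_sum_der, coe_sum_der, F.omega_add_left, F.omega_sum_left, F.omega_sum_left]
  simp only [coe_smul_der, SDer.der, LinConn.covD, insD]
  simp only [F.omega_smul_left H _ (C.isSDer_cov _) (isSDer_ins Z),
    F.omega_smul_left H _ (isSDer_ins _) (isSDer_ins Z), F.omega_cov_ins, F.omega_ins_ins,
    mul_zero, Finset.sum_const_zero, add_zero, mul_neg, Finset.sum_neg_distrib]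

/-- The value of `ω_H` at `D`, `∇_Z` in terms of the components of `D`. -/
theorem Frame.omega_der_cov (F : Frame R N) (H : VF R ≃ₗ[R] OneForm R) {C : LinConn R}
    (hC : C.IsSymmetric) (hCH : C.Preserves H) (E : Der R) (Z : VF R) :
    F.omega H E.1 (C.cov Z) = ∑ i, F.compIns C i E.1 * fn (H Z (F.X i)) := by
  conv_lhs => rw [F.der_eq_sum C E]
  rw [coe_add_der, coe_sum_der, coe_sum_der, F.omega_add_left, F.omega_sum_left, F.omega_sum_left]
  simp only [coe_smul_der, SDer.der, LinConn.covD, insD]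
  simp only [F.omega_smul_left H _ (C.isSDer_cov _) (C.isSDer_cov Z),
    F.omega_smul_left H _ (isSDer_ins _) (C.isSDer_cov Z), F.omega_cov_cov H hC hCH,
    F.omega_ins_cov, mul_zero, Finset.sum_const_zero, zero_add]

/-! ### The morphism `ω^♭` -/

theorem Frame.omegaFlat_eq (F : Frame R N) (H : VF R ≃ₗ[R] OneForm R) (D₀ : SDer R 0)
    (D₁ : SDer R 1) (D' : Op R) :
    F.omegaFlat H (D₀.der + D₁.der).1 D' = F.omega H D₀.1 D' + grad (F.omega H D₁.1 D') := by
  change ∑ p : ZMod 2, tw p (F.omega H (part p (D₀.1 + D₁.1)) D') = _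
  have h : ∀ f : ZMod 2 → Forms R, ∑ p, f p = f 0 + f 1 := fun f => Fin.sum_univ_two f
  rw [h, part_add, part_add, D₀.2.part_self, D₁.2.part_self, D₁.2.part_of_ne zero_ne_one,
    D₀.2.part_of_ne one_ne_zero, add_zero, zero_add, tw_zero, tw_one]

theorem Frame.omegaFlat_ins (F : Frame R N) (H : VF R ≃ₗ[R] OneForm R) (C : LinConn R)
    (E : Der R) (Z : VF R) :
    F.omegaFlat H E.1 (ins Z) = -∑ i, grad (F.compCov i E.1) * fn (H (F.X i) Z) := by
  obtain ⟨D₀, D₁, rfl⟩ := exists_sder_add E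
  rw [F.omegaFlat_eq]
  have h₀ := F.omega_der_ins H C D₀.der Z
  have h₁ := F.omega_der_ins H C D₁.der Z
  change F.omega H D₀.1 _ = _ at h₀
  change F.omega H D₁.1 _ = _ at h₁
  rw [h₀, h₁, map_neg, map_sum, ← neg_add, ← Finset.sum_add_distrib]
  congr 1
  refine Finset.sum_congr rfl fun i _ => ?_
  rw [map_mul, grad_fn, coe_add_der, F.compCov_add, map_add, add_mul]
  congr 2
  exact (isHomog_zero_iff.1 (F.homog_compCov i D₀.2)).symm

theorem Frame.omegaFlat_cov (F : Frame R N) (H : VF R ≃ₗ[R] OneForm R) {C : LinConn R}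
    (hC : C.IsSymmetric) (hCH : C.Preserves H) (E : Der R) (Z : VF R) :
    F.omegaFlat H E.1 (C.cov Z) = ∑ i, F.compIns C i E.1 * fn (H Z (F.X i)) := by
  obtain ⟨D₀, D₁, rfl⟩ := exists_sder_add E
  rw [F.omegaFlat_eq]
  have h₀ := F.omega_der_cov H hC hCH D₀.der Z
  have h₁ := F.omega_der_cov H hC hCH D₁.der Z
  change F.omega H D₀.1 _ = _ at h₀
  change F.omega H D₁.1 _ = _ at h₁
  rw [h₀, h₁, map_sum, ← Finset.sum_add_distrib]
  refine Finset.sum_congr rfl fun i _ => ?_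
  rw [map_mul, grad_fn, coe_add_der, F.compIns_add, add_mul]
  congr 2
  exact isHomog_zero_iff.1 (F.homog_compIns C i D₁.2)

/-- `ω^♭(D)` is a left linear form. -/
theorem Frame.omegaFlat_eq_sum (F : Frame R N) (H : VF R ≃ₗ[R] OneForm R) (C : LinConn R)
    (E E' : Der R) : F.omegaFlat H E.1 E'.1 =
      ∑ i, F.compCov i E'.1 * F.omegaFlat H E.1 (C.cov (F.X i))
        + ∑ i, F.compIns C i E'.1 * F.omegaFlat H E.1 (ins (F.X i)) := by
  obtain ⟨D₀, D₁, rfl⟩ := exists_sder_add E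
  simp only [F.omegaFlat_eq]
  conv_lhs => rw [F.der_eq_sum C E']
  simp only [coe_add_der, coe_sum_der, coe_smul_der, F.omega_add_right, F.omega_sum_right]
  simp only [SDer.der, LinConn.covD, insD]
  simp only [F.omega_smul_right H _ D₀.2 (C.isSDer_cov _), F.omega_smul_right H _ D₀.2
    (isSDer_ins _), F.omega_smul_right H _ D₁.2 (C.isSDer_cov _), F.omega_smul_right H _ D₁.2
    (isSDer_ins _), tw_zero, tw_one, map_add, map_sum, map_mul, grad_grad, mul_add,
    Finset.sum_add_distrib]
  abel

/-! ### Inversion of `ω^♭` -/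

/-- The vector field `H⁻¹(d g k)`. -/
def Frame.raised (F : Frame R N) (H : VF R ≃ₗ[R] OneForm R) (k : Fin N) : VF R :=
  H.symm (dfun (F.g k))

theorem Frame.apply_raised (F : Frame R N) (H : VF R ≃ₗ[R] OneForm R) (k : Fin N) (Y : VF R) :
    H (F.raised H k) Y = Y (F.g k) := by
  rw [Frame.raised, LinearEquiv.apply_symm_apply]; rfl

theorem mul_fn_mul (α : Forms R) (a b : R) : α * fn (a * b) = fn a * (α * fn b) := by
  rw [fn, map_mul, ← mul_assoc, ← fn_mul_comm a, mul_assoc]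

theorem fn_mul_fn_self {ε : R} (hε : ε * ε = 1) (α : Forms R) : fn ε * (fn ε * α) = α := by
  rw [← mul_assoc, fn, ← map_mul, hε, map_one, one_mul]

theorem Frame.compCov_eq_omegaFlat (F : Frame R N) {H : VF R ≃ₗ[R] OneForm R} (C : LinConn R)
    {ε : R} (hε : ε * ε = 1) (hH : ∀ X Y, H X Y = ε * H Y X) (k : Fin N) (E : Der R) :
    F.compCov k E.1 = -(fn ε * grad (F.omegaFlat H E.1 (ins (F.raised H k)))) := by
  have h : F.omegaFlat H E.1 (ins (F.raised H k)) = -(fn ε * grad (F.compCov k E.1)) := by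
    rw [F.omegaFlat_ins H C, Frame.compCov, ← F.sum_compCov_mul, map_sum, Finset.mul_sum]
    congr 1
    refine Finset.sum_congr rfl fun i _ => ?_
    rw [hH, F.apply_raised, map_mul, grad_fn, mul_fn_mul]
  rw [h, map_neg, map_mul, grad_fn, grad_grad, mul_neg, neg_neg, fn_mul_fn_self hε]

theorem Frame.compIns_eq_omegaFlat (F : Frame R N) {H : VF R ≃ₗ[R] OneForm R} {C : LinConn R}
    (hC : C.IsSymmetric) (hCH : C.Preserves H) (k : Fin N) (E : Der R) :
    F.compIns C k E.1 = F.omegaFlat H E.1 (C.cov (F.raised H k)) := by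
  rw [F.omegaFlat_cov H hC hCH, ← F.sum_compIns_mul]
  exact Finset.sum_congr rfl fun i _ => by rw [F.apply_raised]

/-- Non-degeneracy of `ω_H`. -/
theorem Frame.omegaFlat_injective (F : Frame R N) {H : VF R ≃ₗ[R] OneForm R} {C : LinConn R}
    (hC : C.IsSymmetric) (hCH : C.Preserves H) {ε : R} (hε : ε * ε = 1)
    (hH : ∀ X Y, H X Y = ε * H Y X) {E E' : Der R}
    (h : ∀ (r : ZMod 2) (D : SDer R r), F.omegaFlat H E.1 D.1 = F.omegaFlat H E'.1 D.1) :
    E = E' := by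
  rw [F.der_eq_sum C E, F.der_eq_sum C E']
  congr 1
  · refine Finset.sum_congr rfl fun k _ => ?_
    have hk : F.omegaFlat H E.1 (ins _) = F.omegaFlat H E'.1 (ins _) := h 1 (insD (F.raised H k))
    rw [F.compCov_eq_omegaFlat C hε hH, hk, F.compCov_eq_omegaFlat C hε hH]
  · refine Finset.sum_congr rfl fun k _ => ?_
    have hk : F.omegaFlat H E.1 (C.cov _) = F.omegaFlat H E'.1 (C.cov _) :=
      h 0 (C.covD (F.raised H k))
    rw [F.compIns_eq_omegaFlat hC hCH, hk, F.compIns_eq_omegaFlat hC hCH]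

/-- Surjectivity of `ω^♭`: a left linear form is determined by its values `u k`, `v k` at `∇_{X k}`,
`i_{X k}`, and the sum of the `ε u k i_{W k} - grad (v k) ∇_{W k}` with `W k = H⁻¹(d g k)` is a
preimage. -/
theorem Frame.exists_omegaFlat_eq (F : Frame R N) {H : VF R ≃ₗ[R] OneForm R} {C : LinConn R}
    (hC : C.IsSymmetric) (hCH : C.Preserves H) {ε : R} (hε : ε * ε = 1)
    (hH : ∀ X Y, H X Y = ε * H Y X) (u v : Fin N → Forms R) :
    ∃ E : Der R, ∀ E' : Der R, F.omegaFlat H E.1 E'.1 =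
      ∑ k, F.compCov k E'.1 * u k + ∑ k, F.compIns C k E'.1 * v k := by
  let E : Der R := ∑ k, (fn ε * u k) • (insD (F.raised H k)).der
    + ∑ k, (-grad (v k)) • (C.covD (F.raised H k)).der
  have hc : ∀ j, F.compCov j E.1 = -∑ k, grad (v k) * fn (F.raised H k (F.g j)) := fun j => by
    simp only [E, coe_add_der, coe_sum_der, coe_smul_der, F.compCov_add, F.compCov_sum,
      F.compCov_smul, SDer.der, LinConn.covD, insD]
    simp only [Frame.compCov, ins_fn, C.cov_fn, mul_zero, Finset.sum_const_zero, zero_add,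
      neg_mul, Finset.sum_neg_distrib]
  have hi : ∀ j, F.compIns C j E.1 = ∑ k, fn ε * u k * fn (F.raised H k (F.g j)) := fun j => by
    simp only [E, coe_add_der, coe_sum_der, coe_smul_der, F.compIns_add, F.compIns_sum,
      F.compIns_smul, SDer.der, LinConn.covD, insD, F.compIns_ins, F.compIns_cov, mul_zero,
      Finset.sum_const_zero, add_zero]
  have hHY : ∀ W Y : VF R, fn (H W Y) = ∑ j, fn (W (F.g j)) * fn (H (F.X j) Y) := fun W Y => by
    conv_lhs => rw [F.expand W]
    rw [map_sum, LinearMap.sum_apply, fn_sum]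
    exact Finset.sum_congr rfl fun j _ => by
      rw [map_smul, LinearMap.smul_apply, smul_eq_mul, fn, map_mul]
  have hins : ∀ Y, F.omegaFlat H E.1 (ins Y) = ∑ k, v k * fn (Y (F.g k)) := fun Y => by
    rw [F.omegaFlat_ins H C]
    simp only [hc, map_neg, map_sum, map_mul, grad_grad, grad_fn, neg_mul, Finset.sum_neg_distrib,
      neg_neg, Finset.sum_mul]
    rw [Finset.sum_comm]
    refine Finset.sum_congr rfl fun k _ => ?_
    rw [← F.apply_raised H, hHY, Finset.mul_sum]
    exact Finset.sum_congr rfl fun j _ => mul_assoc _ _ _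
  have hcov : ∀ Y, F.omegaFlat H E.1 (C.cov Y) = ∑ k, u k * fn (Y (F.g k)) := fun Y => by
    rw [F.omegaFlat_cov H hC hCH]
    simp only [hi, Finset.sum_mul]
    rw [Finset.sum_comm]
    refine Finset.sum_congr rfl fun k _ => ?_
    rw [← F.apply_raised H, hHY, Finset.mul_sum]
    refine Finset.sum_congr rfl fun j _ => ?_
    rw [hH Y, mul_fn_mul, mul_assoc (fn ε), mul_assoc (fn ε), fn_mul_fn_self hε, mul_assoc]
  refine ⟨E, fun E' => ?_⟩
  rw [F.omegaFlat_eq_sum H C]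
  simp only [hins, hcov, Finset.mul_sum]
  rw [Finset.sum_comm]
  conv_lhs => rw [add_comm, Finset.sum_comm, add_comm]
  congr 1
  · refine Finset.sum_congr rfl fun k _ => ?_
    rw [Frame.compCov, ← F.sum_compCov_mul E', Finset.sum_mul]
    exact Finset.sum_congr rfl fun j _ => by rw [mul_assoc, fn_mul_comm]
  · refine Finset.sum_congr rfl fun k _ => ?_
    rw [← F.sum_compIns_mul C E', Finset.sum_mul]
    exact Finset.sum_congr rfl fun j _ => by rw [mul_assoc, fn_mul_comm]

/-! ### The Ricci operator -/

theorem Superconnection.curv_add (S : Superconnection R) {p q : ZMod 2} (D : SDer R p)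
    (D' : SDer R q) (E E' : Der R) :
    S.curv D D' (E + E') = S.curv D D' E + S.curv D D' E' := by
  simp only [Superconnection.curv, map_add, smul_add]; abel

theorem IsSDer.tw_apply {q : ZMod 2} {D : Op R} (hD : IsSDer q D) (p : ZMod 2) (α : Forms R) :
    tw p (D α) = sgn p q • D (tw p α) := by
  rcases parity_eq_zero_or_one p with rfl | rfl
  · rw [tw_zero, tw_zero, sgn_zero_left, one_smul]
  · rw [tw_one, tw_one, hD.parity, sgn, val_one_two, one_mul]

/-- Tensoriality of the curvature for abstract operators `S`, `S'`, `S''` that satisfy Leibniz rules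
with derivations `d`, `d'`, `d d' - s d' d` and twists `t`, `t'`, `t t'`. -/
theorem curvature_smul_of_leibniz {A V : Type*} [Ring A] [AddCommGroup V] [Module A V] {s : ℤ}
    (hs : s * s = 1) {d d' d'' t t' : A → A} {S S' S'' : V → V}
    (hadd : ∀ v w, S (v + w) = S v + S w) (hadd' : ∀ v w, S' (v + w) = S' v + S' w)
    (hS : ∀ a v, S (a • v) = d a • v + t a • S v)
    (hS' : ∀ a v, S' (a • v) = d' a • v + t' a • S' v)
    (hS'' : ∀ a v, S'' (a • v) = d'' a • v + t (t' a) • S'' v)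
    (hd : ∀ a, t' (d a) = s • d (t' a)) (hd' : ∀ a, t (d' a) = s • d' (t a))
    (hd'' : ∀ a, d'' a = d (d' a) - s • d' (d a)) (ht : ∀ a, t' (t a) = t (t' a)) (a : A) (v : V) :
    S (S' (a • v)) - s • S' (S (a • v)) - S'' (a • v) =
      t (t' a) • (S (S' v) - s • S' (S v) - S'' v) := by
  rw [hS, hS', hS'', hadd, hadd', hS, hS, hS', hS', hd, hd', hd'', ht, smul_sub, smul_sub,
    smul_comm (t (t' a)) s, smul_add, smul_add, smul_add, sub_smul, smul_assoc, smul_assoc,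
    smul_assoc, smul_smul s s, hs, one_smul]
  abel

/-- The curvature is tensorial in its last argument. -/
theorem Superconnection.curv_smul (S : Superconnection R) {p q : ZMod 2} (D : SDer R p)
    (D' : SDer R q) (α : Forms R) (E : Der R) :
    S.curv D D' (α • E) = tw (p + q) α • S.curv D D' E := by
  refine (curvature_smul_of_leibniz (sgn_mul_self p q) (S.toFun D.der).map_add
    (S.toFun D'.der).map_add (S.leibniz p D) (S.leibniz q D')
    (fun a v => (S.leibniz (p + q) (bracket D D') a v).trans ?_)
    (fun a => ?_) (D'.2.tw_apply p) (fun _ => rfl) (fun a => ?_) α E).trans ?_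
  · rw [tw_add_apply]; rfl
  · rw [D.2.tw_apply, sgn_symm]
  · rw [← tw_add_apply, add_comm, tw_add_apply]
  · exact congrArg (· • S.curv D D' E) (tw_add_apply p q α).symm

/-- The trace of `D'' ↦ Curv(D, D'') E` over the even directions. -/
def Frame.curvCov (F : Frame R N) (C : LinConn R) (S : Superconnection R) {p : ZMod 2}
    (D : SDer R p) : Der R →+ Forms R :=
  AddMonoidHom.mk' (fun E => ∑ i, F.compCov i (S.curv D (C.covD (F.X i)) E).1) fun E E' => by
    simp only [S.curv_add, coe_add_der, F.compCov_add, Finset.sum_add_distrib]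

/-- The trace of `D'' ↦ Curv(D, D'') E` over the odd directions. -/
def Frame.curvIns (F : Frame R N) (C : LinConn R) (S : Superconnection R) {p : ZMod 2}
    (D : SDer R p) : Der R →+ Forms R :=
  AddMonoidHom.mk' (fun E => ∑ i, F.compIns C i (S.curv D (insD (F.X i)) E).1) fun E E' => by
    simp only [S.curv_add, coe_add_der, F.compIns_add, Finset.sum_add_distrib]

theorem Frame.curvCov_apply (F : Frame R N) (C : LinConn R) (S : Superconnection R) {p : ZMod 2}
    (D : SDer R p) (E : Der R) :
    F.curvCov C S D E = ∑ i, F.compCov i (S.curv D (C.covD (F.X i)) E).1 := rfl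

theorem Frame.curvIns_apply (F : Frame R N) (C : LinConn R) (S : Superconnection R) {p : ZMod 2}
    (D : SDer R p) (E : Der R) :
    F.curvIns C S D E = ∑ i, F.compIns C i (S.curv D (insD (F.X i)) E).1 := rfl

theorem Frame.curvCov_smul (F : Frame R N) (C : LinConn R) (S : Superconnection R) {p : ZMod 2}
    (D : SDer R p) (α : Forms R) (E : Der R) :
    F.curvCov C S D (α • E) = tw p α * F.curvCov C S D E := by
  simp only [F.curvCov_apply, S.curv_smul, coe_smul_der, F.compCov_smul, Finset.mul_sum, add_zero]

theorem Frame.curvIns_smul (F : Frame R N) (C : LinConn R) (S : Superconnection R) {p : ZMod 2}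
    (D : SDer R p) (α : Forms R) (E : Der R) :
    F.curvIns C S D (α • E) = tw p (tw 1 α) * F.curvIns C S D E := by
  simp only [F.curvIns_apply, S.curv_smul, coe_smul_der, F.compIns_smul, Finset.mul_sum,
    tw_add_apply]

theorem ricci_eq (F : Frame R N) (C : LinConn R) (S : Superconnection R) {p r : ZMod 2}
    (D : SDer R p) (D' : SDer R r) :
    ricci F C S D D' = F.curvCov C S D D'.der - sgn r 1 • F.curvIns C S D D'.der := by
  have h : ∀ (c : ℤ) (i : Fin N) (E : Der R), F.compIns C i (c • E).1 = c • F.compIns C i E.1 :=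
    fun c i E => map_zsmul (F.compInsLin C i) c E.1
  rw [ricci, Frame.supertrace]
  simp only [h, sgn_zero_right, one_smul, ← Finset.smul_sum]
  rfl

/-- `Ric^♭(D)` is a left linear form. -/
theorem ricciFlat_eq_sum (F : Frame R N) (C : LinConn R) (S : Superconnection R) {p r : ZMod 2}
    (D : SDer R p) (D' : SDer R r) : ricciFlat F C S D D' =
      ∑ k, F.compCov k D'.der.1 * ricciFlat F C S D (C.covD (F.X k))
        + ∑ k, F.compIns C k D'.der.1 * ricciFlat F C S D (insD (F.X k)) := by
  have e : ∀ r : ZMod 2, sgn 1 (r + 1) = -sgn r 1 := by decide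
  simp only [ricciFlat, ricci_eq]
  conv_lhs => rw [F.der_eq_sum C D'.der]
  have hc := fun k => (F.homog_compCov k D'.2).tw_eq 1
  have hi := fun k => (F.homog_compIns C k D'.2).tw_eq 1
  change ∀ k, tw 1 (F.compCov k D'.der.1) = _ • F.compCov k D'.der.1 at hc
  change ∀ k, tw 1 (F.compIns C k D'.der.1) = _ • F.compIns C k D'.der.1 at hi
  simp only [map_add, map_sum, F.curvCov_smul, F.curvIns_smul, hc, hi, map_zsmul, smul_mul_assoc,
    sgn_zero_left, sgn_one_one, map_sub, map_mul, tw_tw, smul_add, Finset.smul_sum, smul_smul,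
    e, sgn_symm 1 r, smul_neg, neg_mul, neg_smul, one_smul, sgn_mul_self, mul_sub, mul_add,
    Finset.sum_sub_distrib, Finset.sum_add_distrib, Finset.sum_neg_distrib, sub_neg_eq_add]
  abel

theorem existsUnique_isRicciOperator (F : Frame R N) {C : LinConn R} {H : VF R ≃ₗ[R] OneForm R}
    (hC : C.IsSymmetric) (hCH : C.Preserves H) {ε : R} (hε : ε * ε = 1)
    (hH : ∀ X Y, H X Y = ε * H Y X) (S : Superconnection R) :
    ∃! Φ, IsRicciOperator F C H S Φ := by
  choose Φ hΦ using fun (p : ZMod 2) (D : SDer R p) =>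
    F.exists_omegaFlat_eq hC hCH hε hH (fun k => ricciFlat F C S D (C.covD (F.X k)))
      fun k => ricciFlat F C S D (insD (F.X k))
  refine ⟨Φ, fun p r D D' => ?_, fun Ψ hΨ => ?_⟩
  · rw [ricciFlat_eq_sum]
    exact hΦ p D D'.der
  · funext p D
    refine F.omegaFlat_injective hC hCH hε hH fun r D' => ?_
    rw [hΨ p r D D', ricciFlat_eq_sum]
    exact (hΦ p D D'.der).symm

/-- The odd scalar curvature is a contraction with `H⁻¹` of the mixed components of the Ricci
tensor: `ω_H` is odd and pairs the even directions with the odd ones. -/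
theorem IsRicciOperator.supertrace_eq {F : Frame R N} {C : LinConn R} {H : VF R ≃ₗ[R] OneForm R}
    (hC : C.IsSymmetric) (hCH : C.Preserves H) {ε : R} (hε : ε * ε = 1)
    (hH : ∀ X Y, H X Y = ε * H Y X) {S : Superconnection R}
    {Φ : (p : ZMod 2) → SDer R p → Der R} (hΦ : IsRicciOperator F C H S Φ) :
    F.supertrace C Φ =
      -(fn ε * grad (∑ i, ricci F C S (C.covD (F.X i)) (insD (F.raised H i))))
        - grad (∑ i, ricci F C S (insD (F.X i)) (C.covD (F.raised H i))) := by
  rw [Frame.supertrace, map_sum, map_sum, Finset.mul_sum, ← Finset.sum_neg_distrib]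
  congr 1
  · refine Finset.sum_congr rfl fun i _ => ?_
    rw [F.compCov_eq_omegaFlat C hε hH]
    have h := hΦ 0 1 (C.covD (F.X i)) (insD (F.raised H i))
    rw [ricciFlat, tw_zero] at h
    rw [← h]
    rfl
  · refine Finset.sum_congr rfl fun i _ => ?_
    rw [F.compIns_eq_omegaFlat hC hCH]
    have h := hΦ 1 0 (insD (F.X i)) (C.covD (F.raised H i))
    rw [ricciFlat, tw_one] at h
    exact h

/-! ### Constraints on the tensor fields -/

theorem coe_der {p : ZMod 2} (D : SDer R p) : D.der.1 = D.1 := rfl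

theorem LinConn.coe_covD (C : LinConn R) (X : VF R) : (C.covD X).1 = C.cov X := rfl

theorem coe_insD (X : VF R) : (insD X).1 = ins X := rfl

/-- The one-form `θ ∘ A` in terms of the coefficients of `i_A`. -/
theorem Frame.sum_form1_mul (F : Frame R N) (A : VF R →ₗ[R] VF R) (θ : OneForm R) :
    ∑ j, form1 (dfun (F.g j) ∘ₗ A) * fn (θ (F.X j)) = form1 (θ ∘ₗ A) := by
  have h : θ ∘ₗ A = ∑ j, θ (F.X j) • (dfun (F.g j) ∘ₗ A) := by
    conv_lhs => rw [F.oneForm_eq_sum θ]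
    ext V
    simp only [LinearMap.comp_apply, LinearMap.sum_apply, LinearMap.smul_apply]
  rw [h, form1, map_sum]
  refine Finset.sum_congr rfl fun j _ => ?_
  rw [map_smul, Algebra.smul_def, fn_mul_comm]

theorem Frame.coe_insEnd (F : Frame R N) (A : VF R →ₗ[R] VF R) :
    (F.insEnd A).1 = ∑ j, form1 (dfun (F.g j) ∘ₗ A) • ins (F.X j) :=
  coe_sum_der _ _

theorem Frame.compIns_insEnd (F : Frame R N) (C : LinConn R) (j : Fin N)
    (A : VF R →ₗ[R] VF R) : F.compIns C j (F.insEnd A).1 = form1 (dfun (F.g j) ∘ₗ A) := by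
  rw [F.coe_insEnd, F.compIns_sum, ← F.sum_form1_mul A (dfun (F.g j))]
  exact Finset.sum_congr rfl fun i _ => by rw [F.compIns_smul, F.compIns_ins]; rfl

theorem Frame.omega_insEnd_cov (F : Frame R N) (H : VF R ≃ₗ[R] OneForm R) (C : LinConn R)
    (A : VF R →ₗ[R] VF R) (Z : VF R) :
    F.omega H (F.insEnd A).1 (C.cov Z) = form1 (H Z ∘ₗ A) := by
  rw [F.coe_insEnd, F.omega_sum_left, ← F.sum_form1_mul]
  exact Finset.sum_congr rfl fun i _ => by
    rw [F.omega_smul_left H _ (isSDer_ins _) (C.isSDer_cov _), F.omega_ins_cov]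

theorem Frame.omega_cov_insEnd (F : Frame R N) (H : VF R ≃ₗ[R] OneForm R) (C : LinConn R)
    (A : VF R →ₗ[R] VF R) (Z : VF R) :
    F.omega H (C.cov Z) (F.insEnd A).1 = -form1 (H Z ∘ₗ A) := by
  rw [F.coe_insEnd, F.omega_sum_right, ← F.sum_form1_mul, ← Finset.sum_neg_distrib]
  exact Finset.sum_congr rfl fun i _ => by
    rw [F.omega_smul_right H _ (C.isSDer_cov _) (isSDer_ins _), F.omega_cov_ins, tw_zero, mul_neg]

theorem fn_neg (f : R) : fn (-f) = -fn f := map_neg _ _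

theorem form1_injective : Function.Injective (form1 : OneForm R → Forms R) :=
  ExteriorAlgebra.ι_leftInverse.injective

theorem Superconnection.IsSymmetric.bracket_der {S : Superconnection R} (hS : S.IsSymmetric)
    {p q : ZMod 2} (D : SDer R p) (D' : SDer R q) :
    (bracket D D').der = S.toFun D.der D'.der - sgn p q • S.toFun D'.der D.der :=
  (sub_eq_zero.1 (hS p q D D')).symm

theorem coe_sub_der (E E' : Der R) : (E - E').1 = E.1 - E'.1 := rfl

theorem sub_neg_one_smul_der (E E' : Der R) : E - (-1 : ℤ) • E' = E + E' := by
  apply Subtype.ext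
  change E.1 - (-1 : ℤ) • E'.1 = E.1 + E'.1
  rw [neg_smul, one_smul, sub_neg_eq_add]

section Constraints

variable {F : Frame R N} {C : LinConn R} {H : VF R ≃ₗ[R] OneForm R} {S : Superconnection R}
  {K₀ K₁ K₂ K₃ L₁ L₂ L₃ : VF R →ₗ[R] VF R →ₗ[R] VF R}
  {L₀ : VF R →ₗ[R] VF R →ₗ[R] (VF R →ₗ[R] VF R)}

theorem IsGivenBy.K₁_eq_K₂ (hS : IsGivenBy F C S K₀ K₁ K₂ K₃ L₁ L₂ L₃ L₀)
    (hsymm : S.IsSymmetric) (X Y : VF R) : K₁ X Y = K₂ Y X := by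
  ext f
  apply fn_injective
  have h := congrArg (fun E : Der R => E.1 (fn f)) (hsymm.bracket_der (C.covD X) (insD Y))
  have e : (bracket (C.covD X) (insD Y)).1 (fn f) = 0 := by
    change comm 0 1 (C.cov X) (ins Y) (fn f) = 0
    simp only [comm, LinearMap.sub_apply, LinearMap.smul_apply, LinearMap.comp_apply, ins_fn,
      C.cov_fn, map_zero, smul_zero, sub_zero]
  simp only [hS.cov_ins, hS.ins_cov, sgn_zero_left, one_smul, e, coe_sub_der, coe_add_der, coe_der,
    C.coe_covD, coe_insD, LinearMap.sub_apply, LinearMap.add_apply, C.cov_fn, ins_fn,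
    add_zero] at h
  exact sub_eq_zero.1 h.symm

theorem IsGivenBy.bracket_ins_ins (hS : IsGivenBy F C S K₀ K₁ K₂ K₃ L₁ L₂ L₃ L₀)
    (hsymm : S.IsSymmetric) (X Y : VF R) : (bracket (insD X) (insD Y)).der =
      (C.covD (K₃ X Y)).der + (insD (L₃ X Y)).der
        + ((C.covD (K₃ Y X)).der + (insD (L₃ Y X)).der) := by
  rw [hsymm.bracket_der, hS.ins_ins, hS.ins_ins, sgn_one_one, sub_neg_one_smul_der]

theorem IsGivenBy.K₃_antisymm (hS : IsGivenBy F C S K₀ K₁ K₂ K₃ L₁ L₂ L₃ L₀)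
    (hsymm : S.IsSymmetric) (X Y : VF R) : K₃ X Y = -K₃ Y X := by
  ext f
  apply fn_injective
  have h := congrArg (fun E : Der R => E.1 (fn f)) (hS.bracket_ins_ins hsymm X Y)
  have e : (bracket (insD X) (insD Y)).1 (fn f) = 0 := by
    change comm 1 1 (ins X) (ins Y) (fn f) = 0
    simp only [comm, LinearMap.sub_apply, LinearMap.smul_apply, LinearMap.comp_apply, ins_fn,
      map_zero, smul_zero, sub_zero]
  simp only [e, coe_add_der, coe_der,
    C.coe_covD, coe_insD, LinearMap.add_apply, C.cov_fn, ins_fn, add_zero] at h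
  rw [Derivation.neg_apply, fn_neg]
  exact eq_neg_of_add_eq_zero_left h.symm

theorem IsGivenBy.L₃_antisymm (hS : IsGivenBy F C S K₀ K₁ K₂ K₃ L₁ L₂ L₃ L₀)
    (hsymm : S.IsSymmetric) (X Y : VF R) : L₃ X Y = -L₃ Y X := by
  ext f
  apply fn_injective
  have h := congrArg (fun E : Der R => E.1 (form1 (dfun f))) (hS.bracket_ins_ins hsymm X Y)
  have e : (bracket (insD X) (insD Y)).1 (form1 (dfun f)) = 0 := by
    change comm 1 1 (ins X) (ins Y) (form1 (dfun f)) = 0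
    simp only [comm, LinearMap.sub_apply, LinearMap.smul_apply, LinearMap.comp_apply, ins_fn,
      ins_form1, smul_zero, sub_zero]
  have hK : C.cov (K₃ X Y) (form1 (dfun f)) + C.cov (K₃ Y X) (form1 (dfun f)) = 0 := by
    have h' : C.onOneForm (K₃ X Y) (dfun f) + C.onOneForm (K₃ Y X) (dfun f) = 0 := by
      ext Z
      change (K₃ X Y) (dfun f Z) - dfun f (C.toFun (K₃ X Y) Z)
        + ((K₃ Y X) (dfun f Z) - dfun f (C.toFun (K₃ Y X) Z)) = 0
      rw [hS.K₃_antisymm hsymm X Y, map_neg, LinearMap.neg_apply, map_neg, Derivation.neg_apply]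
      ring
    rw [C.cov_form1, C.cov_form1, ← map_add, h', map_zero]
  simp only [e, coe_add_der, coe_der, C.coe_covD, coe_insD, LinearMap.add_apply, ins_form1] at h
  rw [add_add_add_comm, hK, zero_add] at h
  rw [Derivation.neg_apply, fn_neg]
  exact eq_neg_of_add_eq_zero_left h.symm

theorem IsGivenBy.K₁_symm (hS : IsGivenBy F C S K₀ K₁ K₂ K₃ L₁ L₂ L₃ L₀)
    (hcomp : S.IsCompatible F H) (X Y Z : VF R) : H (K₁ X Y) Z = H (K₁ X Z) Y := by
  apply fn_injective
  have h := hcomp 0 1 1 (C.covD X) (insD Y) (insD Z)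
  rw [hS.cov_ins, hS.cov_ins] at h
  simp only [coe_add_der, coe_der, C.coe_covD, coe_insD, F.omega_add_left, F.omega_add_right,
    F.omega_ins_ins, F.omega_cov_ins, F.omega_ins_cov, sgn_zero_left, one_smul, map_zero,
    add_zero] at h
  rw [eq_comm, neg_add_eq_zero] at h
  exact h

theorem IsGivenBy.K₂_L₃ (hS : IsGivenBy F C S K₀ K₁ K₂ K₃ L₁ L₂ L₃ L₀)
    (hC : C.IsSymmetric) (hCH : C.Preserves H)
    (hcomp : S.IsCompatible F H) (X Y Z : VF R) : H (K₂ X Y) Z = -H Y (L₃ X Z) := by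
  apply fn_injective
  have h := hcomp 1 0 1 (insD X) (C.covD Y) (insD Z)
  rw [hS.ins_cov, hS.ins_ins] at h
  simp only [coe_add_der, coe_der, C.coe_covD, coe_insD, F.omega_add_left, F.omega_add_right,
    F.omega_ins_ins, F.omega_cov_ins, F.omega_cov_cov H hC hCH, sgn_zero_right, one_smul, map_neg,
    add_zero, zero_add, ins_fn, neg_zero] at h
  rw [fn_neg]
  rw [eq_comm, ← neg_add, neg_eq_zero] at h
  exact eq_neg_of_add_eq_zero_left h

theorem IsGivenBy.K₃_alternating (hS : IsGivenBy F C S K₀ K₁ K₂ K₃ L₁ L₂ L₃ L₀)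
    (hcomp : S.IsCompatible F H) (X Y Z : VF R) : H (K₃ X Y) Z = -H (K₃ X Z) Y := by
  apply fn_injective
  have h := hcomp 1 1 1 (insD X) (insD Y) (insD Z)
  rw [hS.ins_ins, hS.ins_ins] at h
  simp only [coe_add_der, coe_der, C.coe_covD, coe_insD, F.omega_add_left, F.omega_add_right,
    F.omega_ins_ins, F.omega_cov_ins, F.omega_ins_cov, sgn_one_one, neg_smul, one_smul, map_zero,
    add_zero] at h
  rw [fn_neg]
  rw [eq_comm, ← neg_add, neg_eq_zero] at h
  exact eq_neg_of_add_eq_zero_left h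

theorem IsGivenBy.L₀_symm (hS : IsGivenBy F C S K₀ K₁ K₂ K₃ L₁ L₂ L₃ L₀)
    (hC : C.IsSymmetric) (hCH : C.Preserves H)
    (hcomp : S.IsCompatible F H) (X Y Z V : VF R) : H Z (L₀ X Y V) = H Y (L₀ X Z V) := by
  have h := hcomp 0 0 0 (C.covD X) (C.covD Y) (C.covD Z)
  rw [hS.cov_cov, hS.cov_cov] at h
  simp only [coe_add_der, coe_der, C.coe_covD, F.omega_add_left, F.omega_add_right,
    F.omega_cov_cov H hC hCH, F.omega_insEnd_cov, F.omega_cov_insEnd, sgn_zero_left, one_smul,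
    map_zero, zero_add] at h
  have h' := form1_injective (eq_of_sub_eq_zero ((sub_eq_add_neg _ _).trans h.symm))
  exact congrArg (fun θ : OneForm R => θ V) h'

/-- `H(K₁(X,Y), Z)` is symmetric in `Y`, `Z` by compatibility in the direction `∇_X`. By
compatibility in odd directions it equals `-H(X, L₃(Y,Z))`, which is antisymmetric in `Y`, `Z`. -/
theorem IsGivenBy.K₁_eq_zero (hS : IsGivenBy F C S K₀ K₁ K₂ K₃ L₁ L₂ L₃ L₀)
    (hC : C.IsSymmetric) (hCH : C.Preserves H) (hsymm : S.IsSymmetric)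
    (hcomp : S.IsCompatible F H) (X Y : VF R) : K₁ X Y = 0 := by
  have hs := hS.K₁_symm hcomp
  have ha : ∀ X Y Z, H (K₁ X Y) Z = -H (K₁ X Z) Y := fun X Y Z => by
    rw [hS.K₁_eq_K₂ hsymm, hS.K₁_eq_K₂ hsymm, hS.K₂_L₃ hC hCH hcomp, hS.K₂_L₃ hC hCH hcomp,
      hS.L₃_antisymm hsymm Y Z, map_neg]
  apply H.injective
  rw [map_zero]
  ext Z
  exact eq_zero_of_eq_neg_self ((hs X Y Z).trans (by rw [ha X Z Y]))

theorem IsGivenBy.K₂_eq_zero (hS : IsGivenBy F C S K₀ K₁ K₂ K₃ L₁ L₂ L₃ L₀)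
    (hC : C.IsSymmetric) (hCH : C.Preserves H) (hsymm : S.IsSymmetric)
    (hcomp : S.IsCompatible F H) (X Y : VF R) : K₂ X Y = 0 := by
  rw [← hS.K₁_eq_K₂ hsymm, hS.K₁_eq_zero hC hCH hsymm hcomp]

theorem IsGivenBy.L₃_eq_zero (hS : IsGivenBy F C S K₀ K₁ K₂ K₃ L₁ L₂ L₃ L₀)
    (hC : C.IsSymmetric) (hCH : C.Preserves H) (hsymm : S.IsSymmetric)
    (hcomp : S.IsCompatible F H) (X Y : VF R) : L₃ X Y = 0 := by
  ext f
  -- `df = H(Z)` for some `Z`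
  have h := hS.K₂_L₃ hC hCH hcomp X (H.symm (dfun f)) Y
  rw [hS.K₂_eq_zero hC hCH hsymm hcomp, map_zero, LinearMap.zero_apply,
    LinearEquiv.apply_symm_apply] at h
  exact neg_eq_zero.1 h.symm

end Constraints

/-! ### Contractions -/

theorem Frame.raised_apply_symm (F : Frame R N) {H : VF R ≃ₗ[R] OneForm R} {ε : R}
    (hH : ∀ X Y, H X Y = ε * H Y X) (j k : Fin N) :
    F.raised H k (F.g j) = ε * F.raised H j (F.g k) := by
  rw [← F.apply_raised H j, ← F.apply_raised H k, hH]

theorem sum_mul_eq_zero_of_antisymm_of_symm {ι : Type*} [Fintype ι] {t q : ι → ι → R}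
    (ht : ∀ i j, t i j = -t j i) (hq : ∀ i j, q i j = q j i) :
    ∑ i, ∑ j, t i j * q i j = 0 := by
  apply eq_zero_of_eq_neg_self
  conv_lhs => rw [Finset.sum_comm]
  rw [← Finset.sum_neg_distrib]
  refine Finset.sum_congr rfl fun i _ => ?_
  rw [← Finset.sum_neg_distrib]
  exact Finset.sum_congr rfl fun j _ => by rw [ht j i, hq j i, neg_mul]

/-- The full contraction with `H⁻¹` of an antisymmetric and a symmetric form vanishes, whichever
symmetry `H` has. -/
theorem Frame.contraction_eq_zero (F : Frame R N) {H : VF R ≃ₗ[R] OneForm R} {ε : R}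
    (hH : ∀ X Y, H X Y = ε * H Y X) (t q : VF R →ₗ[R] VF R →ₗ[R] R)
    (ht : ∀ X Y, t X Y = -t Y X) (hq : ∀ X Y, q X Y = q Y X) :
    ∑ l, ∑ m, t (F.X m) (F.raised H l) * q (F.X l) (F.raised H m) = 0 := by
  have e : ∀ (b : VF R →ₗ[R] VF R →ₗ[R] R) (Y : VF R) (l : Fin N),
      b Y (F.raised H l) = ∑ a, F.raised H l (F.g a) * b Y (F.X a) := fun b Y l => by
    conv_lhs => rw [F.expand (F.raised H l)]
    rw [map_sum]
    exact Finset.sum_congr rfl fun a _ => by rw [map_smul, smul_eq_mul]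
  have e' : ∀ l m, t (F.X m) (F.raised H l) * q (F.X l) (F.raised H m) =
      ∑ a, ∑ b, (F.raised H l (F.g a) * F.raised H m (F.g b)) *
        (t (F.X m) (F.X a) * q (F.X l) (F.X b)) := fun l m => by
    rw [e, e, Finset.sum_mul_sum]
    exact Finset.sum_congr rfl fun a _ => Finset.sum_congr rfl fun b _ => by ring
  apply eq_zero_of_eq_neg_self
  simp only [e']
  have swap : ∀ f : Fin N → Fin N → Fin N → Fin N → R,
      ∑ l, ∑ m, ∑ a, ∑ b, f l m a b = ∑ l, ∑ m, ∑ a, ∑ b, f b a m l := fun f => by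
    calc _ = ∑ x : Fin N × Fin N × Fin N × Fin N, f x.1 x.2.1 x.2.2.1 x.2.2.2 := by
          simp only [Fintype.sum_prod_type]
      _ = ∑ x : Fin N × Fin N × Fin N × Fin N, f x.2.2.2 x.2.2.1 x.2.1 x.1 :=
          Fintype.sum_equiv ⟨fun x => (x.2.2.2, x.2.2.1, x.2.1, x.1),
            fun x => (x.2.2.2, x.2.2.1, x.2.1, x.1), fun _ => rfl, fun _ => rfl⟩ _ _ fun _ => rfl
      _ = _ := by simp only [Fintype.sum_prod_type]
  conv_lhs => rw [swap]
  simp only [← Finset.sum_neg_distrib]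
  refine Finset.sum_congr rfl fun l _ => Finset.sum_congr rfl fun m _ =>
    Finset.sum_congr rfl fun a _ => Finset.sum_congr rfl fun b _ => ?_
  -- transposing each of the two copies of `H⁻¹` costs a factor `ε`
  rw [F.raised_apply_symm hH m b, F.raised_apply_symm hH a l, ht (F.X a), hq (F.X b)]
  ring

section Contractions

variable (F : Frame R N) {H : VF R ≃ₗ[R] OneForm R} {ε : R}
  {K : VF R →ₗ[R] VF R →ₗ[R] VF R} {L : VF R →ₗ[R] VF R →ₗ[R] (VF R →ₗ[R] VF R)}

/-- The form `H(L(X, Y) V, Z)` in the last two of the arguments `X`, `Y`, `Z`. -/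
def lowered (H : VF R ≃ₗ[R] OneForm R) (L : VF R →ₗ[R] VF R →ₗ[R] (VF R →ₗ[R] VF R)) (V X : VF R) :
    VF R →ₗ[R] VF R →ₗ[R] R :=
  H.toLinearMap.flip ∘ₗ LinearMap.applyₗ V ∘ₗ L X

theorem Frame.eq_sum_raised (H : VF R ≃ₗ[R] OneForm R) (Y : VF R) :
    Y = ∑ m, H (F.raised H m) Y • F.X m := by
  conv_lhs => rw [F.expand Y]
  exact Finset.sum_congr rfl fun m _ => by rw [F.apply_raised]

theorem Frame.apply_eq_lowered (hH : ∀ X Y, H X Y = ε * H Y X) (Y : VF R)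
    (l : Fin N) : Y (F.g l) = ε * H Y (F.raised H l) := by
  rw [← F.apply_raised H, hH]

theorem flip_antisymm (hK : ∀ X Y, K X Y = -K Y X)
    (hK' : ∀ X Y Z, H (K X Y) Z = -H (K X Z) Y) (X Y Z : VF R) :
    H (K Y X) Z = -H (K Z X) Y := by
  rw [hK Y, hK Z, map_neg, map_neg, LinearMap.neg_apply, LinearMap.neg_apply, hK' X Y]

/-- The contractions with two copies of `H⁻¹` of `H(K(·,·),·)`, antisymmetric in all its arguments,
and `H(L(·,·) V,·)`, symmetric in the last two, vanish. This is the contraction of `K(L(·,·) V,·)` in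
which the arguments of `L` are joined with the second argument and the value of `K`. -/
theorem Frame.sum_K_L_fst_snd (hH : ∀ X Y, H X Y = ε * H Y X)
    (hK : ∀ X Y, K X Y = -K Y X) (hK' : ∀ X Y Z, H (K X Y) Z = -H (K X Z) Y)
    (hL : ∀ X Y Z V, H Z (L X Y V) = H Y (L X Z V)) (V : VF R) :
    ∑ i, ∑ l, K (L (F.X i) (F.X l) V) (F.raised H i) (F.g l) = 0 := by
  refine Finset.sum_eq_zero fun i _ => ?_
  have hc := F.contraction_eq_zero hH (H.toLinearMap ∘ₗ K.flip (F.raised H i))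
    (lowered H L V (F.X i)) (flip_antisymm hK hK' _) fun Y Z => hL _ _ _ _
  rw [← mul_zero ε, ← hc, Finset.mul_sum]
  refine Finset.sum_congr rfl fun l _ => ?_
  conv_lhs => rw [F.apply_eq_lowered hH, F.eq_sum_raised H (L (F.X i) (F.X l) V)]
  rw [map_sum, LinearMap.sum_apply, map_sum, LinearMap.sum_apply]
  congr 1
  refine Finset.sum_congr rfl fun m _ => ?_
  rw [map_smul, LinearMap.smul_apply, map_smul, LinearMap.smul_apply, smul_eq_mul, mul_comm]
  rfl

/-- The same contraction with the two arguments of `L` exchanged. -/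
theorem Frame.sum_K_L_snd_fst (hH : ∀ X Y, H X Y = ε * H Y X)
    (hK : ∀ X Y, K X Y = -K Y X)
    (hL : ∀ X Y Z V, H Z (L X Y V) = H Y (L X Z V)) (V : VF R) :
    ∑ i, ∑ l, K (L (F.X l) (F.X i) V) (F.raised H i) (F.g l) = 0 := by
  rw [Finset.sum_comm]
  refine Finset.sum_eq_zero fun l _ => ?_
  have hc := F.contraction_eq_zero hH (K.compr₂ (LinearMap.applyₗ (F.raised H l) ∘ₗ H.toLinearMap))
    (lowered H L V (F.X l))
    (fun X Y => by
      change H (K X Y) _ = -H (K Y X) _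
      rw [hK, map_neg, LinearMap.neg_apply]) fun Y Z => hL _ _ _ _
  rw [← mul_zero ε, ← hc, Finset.mul_sum]
  refine Finset.sum_congr rfl fun i _ => ?_
  conv_lhs => rw [F.apply_eq_lowered hH, F.eq_sum_raised H (L (F.X l) (F.X i) V)]
  rw [map_sum, LinearMap.sum_apply, map_sum, LinearMap.sum_apply]
  congr 1
  refine Finset.sum_congr rfl fun m _ => ?_
  rw [map_smul, LinearMap.smul_apply, map_smul, LinearMap.smul_apply, smul_eq_mul, mul_comm]
  rfl

/-- The contraction in which `K` is inserted in the second argument of `L`. -/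
theorem Frame.sum_L_K (hH : ∀ X Y, H X Y = ε * H Y X)
    (hK : ∀ X Y, K X Y = -K Y X) (hK' : ∀ X Y Z, H (K X Y) Z = -H (K X Z) Y)
    (hL : ∀ X Y Z V, H Z (L X Y V) = H Y (L X Z V)) (V : VF R) :
    ∑ i, ∑ l, L (F.X i) (K (F.X l) (F.raised H i)) V (F.g l) = 0 := by
  refine Finset.sum_eq_zero fun i _ => ?_
  have hc := F.contraction_eq_zero hH (H.toLinearMap ∘ₗ K.flip (F.raised H i))
    (lowered H L V (F.X i)) (flip_antisymm hK hK' _) fun Y Z => hL _ _ _ _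
  rw [Finset.sum_comm] at hc
  rw [← mul_zero ε, ← hc, Finset.mul_sum]
  refine Finset.sum_congr rfl fun l _ => ?_
  conv_lhs => rw [← F.apply_raised H, F.expand (K (F.X l) (F.raised H i))]
  rw [map_sum, LinearMap.sum_apply, map_sum, Finset.mul_sum]
  refine Finset.sum_congr rfl fun m _ => ?_
  rw [map_smul, LinearMap.smul_apply, map_smul, smul_eq_mul, F.apply_eq_lowered hH, mul_assoc]
  rfl

/-- The contraction in which `L` is inserted in the second argument of `K`. -/
theorem Frame.sum_K_L_symm (hH : ∀ X Y, H X Y = ε * H Y X) (hK : ∀ X Y, K X Y = -K Y X)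
    (hL : ∀ X Y Z V, H Z (L X Y V) = H Y (L X Z V)) (V : VF R) :
    ∑ i, ∑ l, K (F.X i) (L (F.X l) (F.raised H i) V) (F.g l) = 0 := by
  rw [Finset.sum_comm]
  refine Finset.sum_eq_zero fun l _ => ?_
  have hc := sum_mul_eq_zero_of_antisymm_of_symm (ι := Fin N)
    (t := fun i m => H (K (F.X i) (F.X m)) (F.raised H l))
    (q := fun i m => H (F.raised H m) (L (F.X l) (F.raised H i) V))
    (fun i m => by rw [hK, map_neg, LinearMap.neg_apply]) (fun i m => hL _ _ _ _)
  rw [← mul_zero ε, ← hc, Finset.mul_sum]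
  refine Finset.sum_congr rfl fun i _ => ?_
  conv_lhs => rw [F.apply_eq_lowered hH, F.eq_sum_raised H (L (F.X l) (F.raised H i) V)]
  rw [map_sum, map_sum, LinearMap.sum_apply]
  congr 1
  refine Finset.sum_congr rfl fun m _ => ?_
  rw [map_smul, map_smul, LinearMap.smul_apply, smul_eq_mul, mul_comm]

end Contractions

/-! ### Curvature and the mixed components of the Ricci tensor -/

/-- The covariant derivative is linear over the functions in its direction. -/
theorem Frame.cov_eq_sum (F : Frame R N) (C : LinConn R) (Y : VF R) :
    C.cov Y = ∑ i, fn (Y (F.g i)) • C.cov (F.X i) := by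
  conv_lhs => rw [F.sder_eq_sum C (C.isSDer_cov Y)]
  rw [Finset.sum_eq_zero (f := fun j => F.compIns C j (C.cov Y) • ins (F.X j)), add_zero]
  · exact Finset.sum_congr rfl fun i _ => by rw [Frame.compCov, C.cov_fn]
  · exact fun j _ => by rw [F.compIns_cov, zero_smul]

theorem Frame.covD_add_covD_neg (F : Frame R N) (C : LinConn R) (Y : VF R) :
    (C.covD Y).der + (C.covD (-Y)).der = 0 := by
  apply Subtype.ext
  change C.cov Y + C.cov (-Y) = 0
  rw [F.cov_eq_sum C Y, F.cov_eq_sum C (-Y), ← Finset.sum_add_distrib]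
  exact Finset.sum_eq_zero fun i _ => by
    rw [← add_smul, Derivation.neg_apply, fn_neg, add_neg_cancel, zero_smul]

theorem Superconnection.toFun_add_left (S : Superconnection R) (E E' E'' : Der R) :
    S.toFun (E + E') E'' = S.toFun E E'' + S.toFun E' E'' := by
  rw [map_add]; rfl

theorem Superconnection.toFun_sub_zsmul_left (S : Superconnection R) (c : ℤ) (E E' E'' : Der R) :
    S.toFun (E - c • E') E'' = S.toFun E E'' - c • S.toFun E' E'' := by
  let φ : Der R →+ Der R := AddMonoidHom.mk' (fun E => S.toFun E E'') fun E E' =>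
    S.toFun_add_left E E' E''
  have h : φ (E - c • E') = φ E - φ (c • E') := map_sub φ _ _
  have h' : φ (c • E') = c • φ E' := map_zsmul φ _ _
  rw [h'] at h
  exact h

/-- The curvature of a torsion-free superconnection, without the bracket. -/
theorem Superconnection.IsSymmetric.coe_curv {S : Superconnection R} (hsymm : S.IsSymmetric)
    {p q : ZMod 2} {D : SDer R p} {D' : SDer R q} {E E₁ E₂ B₁ B₂ : Der R}
    (h₁ : S.toFun D.der (S.toFun D'.der E) = E₁) (h₂ : S.toFun D'.der (S.toFun D.der E) = E₂)
    (h₃ : S.toFun (S.toFun D.der D'.der) E = B₁) (h₄ : S.toFun (S.toFun D'.der D.der) E = B₂) :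
    (S.curv D D' E).1 = E₁.1 - sgn p q • E₂.1 - (B₁.1 - sgn p q • B₂.1) := by
  subst h₁ h₂ h₃ h₄
  have h := (congrArg (fun B => S.toFun B E) (hsymm.bracket_der D D')).trans
    (S.toFun_sub_zsmul_left (sgn p q) _ _ E)
  exact congrArg (fun B : Der R => (S.toFun D.der (S.toFun D'.der E)).1
      - sgn p q • (S.toFun D'.der (S.toFun D.der E)).1 - B.1) h

theorem Superconnection.toFun_insEnd_left (S : Superconnection R) (F : Frame R N)
    (A : VF R →ₗ[R] VF R) (E : Der R) : S.toFun (F.insEnd A) E =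
      ∑ j, form1 (dfun (F.g j) ∘ₗ A) • S.toFun (insD (F.X j)).der E := by
  rw [Frame.insEnd, map_sum, LinearMap.sum_apply]
  exact Finset.sum_congr rfl fun j _ => by rw [map_smul]; rfl

theorem Superconnection.toFun_insEnd_right (S : Superconnection R) (F : Frame R N) {p : ZMod 2}
    (D : SDer R p) (A : VF R →ₗ[R] VF R) : S.toFun D.der (F.insEnd A) =
      ∑ j, (D.1 (form1 (dfun (F.g j) ∘ₗ A)) • (insD (F.X j)).der
        + tw p (form1 (dfun (F.g j) ∘ₗ A)) • S.toFun D.der (insD (F.X j)).der) := by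
  rw [Frame.insEnd, map_sum]
  exact Finset.sum_congr rfl fun j _ => S.leibniz p D _ _

/-- A superconnection that acts on the basic supervector fields as a symmetric and compatible one
given by tensor fields does: the tensors `K₁`, `K₂`, `L₃` vanish. The argument `b` stands for the
vector field `∇_X Y + L₁(X, Y)`, `a` for `∇_X Y + K₀(X, Y)` and `c` for `L₂(X, Y)`; the curvature
enters the supertraces only through `K = K₃` and `L = L₀`. -/
structure IsReduced (F : Frame R N) (C : LinConn R) (S : Superconnection R)
    (a b c : VF R → VF R → VF R) (K : VF R →ₗ[R] VF R →ₗ[R] VF R)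
    (L : VF R →ₗ[R] VF R →ₗ[R] (VF R →ₗ[R] VF R)) : Prop where
  cov_cov : ∀ X Y, S.toFun (C.covD X).der (C.covD Y).der = (C.covD (a X Y)).der + F.insEnd (L X Y)
  cov_ins : ∀ X Y, S.toFun (C.covD X).der (insD Y).der = (insD (b X Y)).der
  ins_cov : ∀ X Y, S.toFun (insD X).der (C.covD Y).der = (insD (c X Y)).der
  ins_ins : ∀ X Y, S.toFun (insD X).der (insD Y).der = (C.covD (K X Y)).der

section Curvature

variable {F : Frame R N} {C : LinConn R} {S : Superconnection R} {a b c : VF R → VF R → VF R}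
  {K : VF R →ₗ[R] VF R →ₗ[R] VF R} {L : VF R →ₗ[R] VF R →ₗ[R] (VF R →ₗ[R] VF R)}

theorem coe_covD_der_fn (C : LinConn R) (X : VF R) (f : R) : (C.covD X).der.1 (fn f) = fn (X f) :=
  C.cov_fn X f

theorem coe_insD_der_fn (X : VF R) (f : R) : (insD X).der.1 (fn f) = 0 :=
  ins_fn X f

theorem IsReduced.insEnd_ins_fn (h : IsReduced F C S a b c K L) (A : VF R →ₗ[R] VF R) (Y : VF R)
    (f : R) : (S.toFun (F.insEnd A) (insD Y).der).1 (fn f) =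
      form1 (dfun f ∘ₗ K.flip Y ∘ₗ A) := by
  rw [S.toFun_insEnd_left, coe_sum_der, LinearMap.sum_apply, ← LinearMap.comp_assoc,
    ← F.sum_form1_mul]
  refine Finset.sum_congr rfl fun j _ => ?_
  rw [h.ins_ins, coe_smul_der, smul_op_apply, coe_covD_der_fn]
  rfl

theorem IsReduced.ins_insEnd_fn (h : IsReduced F C S a b c K L) (X : VF R) (A : VF R →ₗ[R] VF R)
    (f : R) : (S.toFun (insD X).der (F.insEnd A)).1 (fn f) = -form1 (dfun f ∘ₗ K X ∘ₗ A) := by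
  rw [S.toFun_insEnd_right, coe_sum_der, LinearMap.sum_apply, ← LinearMap.comp_assoc,
    ← F.sum_form1_mul, ← Finset.sum_neg_distrib]
  refine Finset.sum_congr rfl fun j _ => ?_
  rw [h.ins_ins, coe_add_der, LinearMap.add_apply, coe_smul_der, coe_smul_der, smul_op_apply,
    smul_op_apply, coe_insD_der_fn, coe_covD_der_fn, mul_zero, zero_add, tw_one, grad_form1,
    neg_mul]
  rfl

theorem IsReduced.curv_cov_cov_ins (h : IsReduced F C S a b c K L) (hsymm : S.IsSymmetric)
    (X Z Y : VF R) (f : R) : (S.curv (C.covD X) (C.covD Z) (insD Y).der).1 (fn f) =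
      form1 (dfun f ∘ₗ K.flip Y ∘ₗ L Z X) - form1 (dfun f ∘ₗ K.flip Y ∘ₗ L X Z) := by
  have e : ∀ U W, S.toFun (S.toFun (C.covD U).der (C.covD W).der) (insD Y).der =
      (insD (b (a U W) Y)).der + S.toFun (F.insEnd (L U W)) (insD Y).der := fun U W =>
    (congrArg (S.toFun · (insD Y).der) (h.cov_cov U W)).trans ((S.toFun_add_left _ _ _).trans
      (congrArg (· + _) (h.cov_ins _ _)))
  rw [hsymm.coe_curv ((congrArg _ (h.cov_ins Z Y)).trans (h.cov_ins X _))
    ((congrArg _ (h.cov_ins X Y)).trans (h.cov_ins Z _)) (e X Z) (e Z X), sgn_zero_left]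
  simp only [one_smul, coe_add_der, LinearMap.sub_apply, LinearMap.add_apply, coe_insD_der_fn,
    h.insEnd_ins_fn]
  abel

theorem IsReduced.curv_cov_ins_ins (h : IsReduced F C S a b c K L) (hsymm : S.IsSymmetric)
    (X Z Y : VF R) (j : Fin N) : F.compIns C j (S.curv (C.covD X) (insD Z) (insD Y).der).1 =
      form1 (dfun (F.g j) ∘ₗ L X (K Z Y)) := by
  rw [hsymm.coe_curv ((congrArg _ (h.ins_ins Z Y)).trans (h.cov_cov X _))
    ((congrArg _ (h.cov_ins X Y)).trans (h.ins_ins Z _))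
    ((congrArg (S.toFun · (insD Y).der) (h.cov_ins X Z)).trans (h.ins_ins _ Y))
    ((congrArg (S.toFun · (insD Y).der) (h.ins_cov Z X)).trans (h.ins_ins _ Y)),
    sgn_zero_left, one_smul, one_smul, coe_add_der]
  simp only [coe_der, C.coe_covD, F.compIns_sub, F.compIns_add, F.compIns_cov, F.compIns_insEnd,
    sub_zero, zero_add]

theorem IsReduced.curv_ins_cov_cov (h : IsReduced F C S a b c K L) (hsymm : S.IsSymmetric)
    (X Z Y : VF R) (f : R) : (S.curv (insD X) (C.covD Z) (C.covD Y).der).1 (fn f) =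
      -form1 (dfun f ∘ₗ K X ∘ₗ L Z Y) := by
  have e := (S.toFun (insD X).der).map_add (C.covD (a Z Y)).der (F.insEnd (L Z Y))
  rw [hsymm.coe_curv ((congrArg _ (h.cov_cov Z Y)).trans (e.trans
      (congrArg (· + _) (h.ins_cov X _))))
    ((congrArg _ (h.ins_cov X Y)).trans (h.cov_ins Z _))
    ((congrArg (S.toFun · (C.covD Y).der) (h.ins_cov X Z)).trans (h.ins_cov _ Y))
    ((congrArg (S.toFun · (C.covD Y).der) (h.cov_ins Z X)).trans (h.ins_cov _ Y)),
    sgn_zero_right]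
  simp only [one_smul, coe_add_der, LinearMap.sub_apply, LinearMap.add_apply, coe_insD_der_fn,
    h.ins_insEnd_fn, sub_zero, zero_add]

theorem IsReduced.curv_ins_ins_cov (h : IsReduced F C S a b c K L) (hsymm : S.IsSymmetric)
    (hK : ∀ X Y, K X Y = -K Y X) (X Z Y : VF R) (j : Fin N) :
    F.compIns C j (S.curv (insD X) (insD Z) (C.covD Y).der).1 = 0 := by
  have e := (S.toFun_add_left (C.covD (K X Z)).der (C.covD (-K X Z)).der (C.covD Y).der).symm.trans
    ((congrArg (S.toFun · (C.covD Y).der) (F.covD_add_covD_neg C (K X Z))).trans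
      (LinearMap.congr_fun (map_zero S.toFun) _))
  rw [← hK Z X] at e
  have e' : (S.toFun (C.covD (K X Z)).der (C.covD Y).der).1
      + (S.toFun (C.covD (K Z X)).der (C.covD Y).der).1 = 0 := congrArg Subtype.val e
  rw [hsymm.coe_curv ((congrArg _ (h.ins_cov Z Y)).trans (h.ins_ins X _))
    ((congrArg _ (h.ins_cov X Y)).trans (h.ins_ins Z _))
    (congrArg (S.toFun · (C.covD Y).der) (h.ins_ins X Z))
    (congrArg (S.toFun · (C.covD Y).der) (h.ins_ins Z X)), sgn_one_one]
  simp only [neg_smul, one_smul, sub_neg_eq_add, e', sub_zero]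
  simp only [coe_der, C.coe_covD, F.compIns_add, F.compIns_cov, add_zero]

/-- The contraction with `H⁻¹` of `⟨∇_X, i_Y; Ric⟩` is a sum of full contractions of `K₃` and
`L₀`. -/
theorem IsReduced.sum_ricci_cov_ins (h : IsReduced F C S a b c K L) (hsymm : S.IsSymmetric)
    {H : VF R ≃ₗ[R] OneForm R} {ε : R} (hH : ∀ X Y, H X Y = ε * H Y X)
    (hK : ∀ X Y, K X Y = -K Y X) (hK' : ∀ X Y Z, H (K X Y) Z = -H (K X Z) Y)
    (hL : ∀ X Y Z V, H Z (L X Y V) = H Y (L X Z V)) :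
    ∑ i, ricci F C S (C.covD (F.X i)) (insD (F.raised H i)) = 0 := by
  have e : ∀ X Y, ricci F C S (C.covD X) (insD Y) =
      form1 (∑ l, dfun (F.g l) ∘ₗ K.flip Y ∘ₗ L (F.X l) X)
        - form1 (∑ l, dfun (F.g l) ∘ₗ K.flip Y ∘ₗ L X (F.X l))
        + form1 (∑ l, dfun (F.g l) ∘ₗ L X (K (F.X l) Y)) := fun X Y => by
    rw [ricci_eq, F.curvCov_apply, F.curvIns_apply, sgn_one_one, neg_smul, one_smul, sub_neg_eq_add, form1, form1, form1, map_sum,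
      map_sum, map_sum, ← Finset.sum_sub_distrib]
    exact congrArg₂ (· + ·) (Finset.sum_congr rfl fun l _ => h.curv_cov_cov_ins hsymm X (F.X l) Y (F.g l))
      (Finset.sum_congr rfl fun l _ => h.curv_cov_ins_ins hsymm X (F.X l) Y l)
  have z : ∀ θ : Fin N → OneForm R, (∀ V, ∑ i, θ i V = 0) → ∑ i, form1 (θ i) = 0 :=
    fun θ hθ => by
      rw [← map_sum, show ∑ i, θ i = 0 from LinearMap.ext fun V => by
        rw [LinearMap.sum_apply]; exact hθ V, map_zero]
  simp only [e, Finset.sum_add_distrib, Finset.sum_sub_distrib]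
  rw [z, z, z, sub_zero, add_zero]
  · intro V
    simp only [LinearMap.sum_apply]
    exact F.sum_L_K hH hK hK' hL V
  · intro V
    simp only [LinearMap.sum_apply]
    exact F.sum_K_L_fst_snd hH hK hK' hL V
  · intro V
    simp only [LinearMap.sum_apply]
    exact F.sum_K_L_snd_fst hH hK hL V

/-- The contraction with `H⁻¹` of `⟨i_X, ∇_Y; Ric⟩` is a full contraction of `K₃` and `L₀`. -/
theorem IsReduced.sum_ricci_ins_cov (h : IsReduced F C S a b c K L) (hsymm : S.IsSymmetric)
    {H : VF R ≃ₗ[R] OneForm R} {ε : R} (hH : ∀ X Y, H X Y = ε * H Y X)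
    (hK : ∀ X Y, K X Y = -K Y X)
    (hL : ∀ X Y Z V, H Z (L X Y V) = H Y (L X Z V)) :
    ∑ i, ricci F C S (insD (F.X i)) (C.covD (F.raised H i)) = 0 := by
  have e : ∀ X Y, ricci F C S (insD X) (C.covD Y) =
      -form1 (∑ l, dfun (F.g l) ∘ₗ K X ∘ₗ L (F.X l) Y) := fun X Y => by
    rw [ricci_eq, F.curvCov_apply, F.curvIns_apply, sgn_zero_left, one_smul, form1, map_sum, ← Finset.sum_neg_distrib, ← sub_zero
      (∑ l, -form1 (dfun (F.g l) ∘ₗ K X ∘ₗ L (F.X l) Y))]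
    exact congrArg₂ (· - ·) (Finset.sum_congr rfl fun l _ => h.curv_ins_cov_cov hsymm X (F.X l) Y (F.g l))
      (Finset.sum_eq_zero fun l _ => h.curv_ins_ins_cov hsymm hK X (F.X l) Y l)
  simp only [e]
  rw [Finset.sum_neg_distrib, ← map_sum, neg_eq_zero]
  refine (congrArg form1 (LinearMap.ext fun V => ?_)).trans (map_zero (ExteriorAlgebra.ι R))
  simp only [LinearMap.sum_apply]
  exact F.sum_K_L_symm hH hK hL V

end Curvature

/-- The theorem over an arbitrary algebra of functions that admits global coordinates; the metric
and the symplectic case differ only in the sign `ε`. -/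
theorem IsGivenBy.existsUnique_and_supertrace_eq_zero {F : Frame R N} {C : LinConn R}
    {S : Superconnection R}
    {K₀ K₁ K₂ K₃ L₁ L₂ L₃ : VF R →ₗ[R] VF R →ₗ[R] VF R}
    {L₀ : VF R →ₗ[R] VF R →ₗ[R] (VF R →ₗ[R] VF R)}
    (hS : IsGivenBy F C S K₀ K₁ K₂ K₃ L₁ L₂ L₃ L₀) {H : VF R ≃ₗ[R] OneForm R}
    {ε : R} (hε : ε * ε = 1) (hH : ∀ X Y, H X Y = ε * H Y X)
    (hC : C.IsSymmetric) (hCH : C.Preserves H)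
    (hsymm : S.IsSymmetric) (hcomp : S.IsCompatible F H) :
    (∃! Φ, IsRicciOperator F C H S Φ) ∧ ∀ Φ, IsRicciOperator F C H S Φ → F.supertrace C Φ = 0 := by
  have z₁ : (C.covD 0).der = 0 := by
    apply Subtype.ext
    change C.cov 0 = 0
    rw [F.cov_eq_sum C]
    exact Finset.sum_eq_zero fun i _ => by rw [Derivation.zero_apply, fn, map_zero, zero_smul]
  have z₂ : (insD (0 : VF R)).der = 0 := by
    apply Subtype.ext
    change ins 0 = 0
    refine op_eq_zero (isSDer_ins (0 : VF R)).leibniz (fun f => ins_fn _ f) fun θ => ?_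
    rw [ins_form1, map_zero, fn, map_zero]
  have h : IsReduced F C S (fun X Y => C.toFun X Y + K₀ X Y) (fun X Y => C.toFun X Y + L₁ X Y)
      (fun X Y => L₂ X Y) K₃ L₀ :=
    { cov_cov := hS.cov_cov
      cov_ins := fun X Y => by
        rw [hS.cov_ins, hS.K₁_eq_zero hC hCH hsymm hcomp, z₁, zero_add]
      ins_cov := fun X Y => by
        rw [hS.ins_cov, hS.K₂_eq_zero hC hCH hsymm hcomp, z₁, zero_add]
      ins_ins := fun X Y => by
        rw [hS.ins_ins, hS.L₃_eq_zero hC hCH hsymm hcomp, z₂, add_zero] }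
  refine ⟨existsUnique_isRicciOperator F hC hCH hε hH S, fun Φ hΦ => ?_⟩
  have hK := hS.K₃_antisymm hsymm
  have hL := hS.L₀_symm hC hCH hcomp
  rw [hΦ.supertrace_eq hC hCH hε hH,
    h.sum_ricci_cov_ins hsymm hH hK (hS.K₃_alternating hcomp) hL,
    h.sum_ricci_ins_cov hsymm hH hK hL, map_zero, mul_zero, neg_zero, sub_zero]

theorem IsSymplectic.antisymm {H : VF R ≃ₗ[R] OneForm R} (hH : IsSymplectic H) (X Y : VF R) :
    H X Y = -1 * H Y X := by
  have h := hH.1 (X + Y)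
  simp only [map_add, LinearMap.add_apply, hH.1, zero_add, add_zero] at h
  rw [neg_one_mul]
  exact eq_neg_of_add_eq_zero_right h

end CartanKoszul

theorem mainTheorem1 {n : ℕ} {M : Type*} [TopologicalSpace M] [T2Space M]
    [SecondCountableTopology M] [ChartedSpace (EuclideanSpace ℝ (Fin n)) M]
    [IsManifold (𝓡 n) ∞ M]
    (H : CartanKoszul.VF C^∞⟮𝓡 n, M; ℝ⟯ ≃ₗ[C^∞⟮𝓡 n, M; ℝ⟯] CartanKoszul.OneForm C^∞⟮𝓡 n, M; ℝ⟯)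
    (hH : CartanKoszul.IsRiemannian H ∨ CartanKoszul.IsSymplectic H)
    (C : CartanKoszul.LinConn C^∞⟮𝓡 n, M; ℝ⟯) (hC : C.IsSymmetric) (hCH : C.Preserves H)
    {N : ℕ} (F : CartanKoszul.Frame C^∞⟮𝓡 n, M; ℝ⟯ N)
    (S : CartanKoszul.Superconnection C^∞⟮𝓡 n, M; ℝ⟯)
    (K₀ K₁ K₂ K₃ L₁ L₂ L₃ : CartanKoszul.VF C^∞⟮𝓡 n, M; ℝ⟯ →ₗ[C^∞⟮𝓡 n, M; ℝ⟯]
      CartanKoszul.VF C^∞⟮𝓡 n, M; ℝ⟯ →ₗ[C^∞⟮𝓡 n, M; ℝ⟯] CartanKoszul.VF C^∞⟮𝓡 n, M; ℝ⟯)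
    (L₀ : CartanKoszul.VF C^∞⟮𝓡 n, M; ℝ⟯ →ₗ[C^∞⟮𝓡 n, M; ℝ⟯]
      CartanKoszul.VF C^∞⟮𝓡 n, M; ℝ⟯ →ₗ[C^∞⟮𝓡 n, M; ℝ⟯]
      (CartanKoszul.VF C^∞⟮𝓡 n, M; ℝ⟯ →ₗ[C^∞⟮𝓡 n, M; ℝ⟯] CartanKoszul.VF C^∞⟮𝓡 n, M; ℝ⟯))
    (hS : CartanKoszul.IsGivenBy F C S K₀ K₁ K₂ K₃ L₁ L₂ L₃ L₀)
    (hsymm : S.IsSymmetric) (hcomp : S.IsCompatible F H) :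
    (∃! Φ, CartanKoszul.IsRicciOperator F C H S Φ) ∧
      ∀ Φ, CartanKoszul.IsRicciOperator F C H S Φ → F.supertrace C Φ = 0 := by
  rcases hH with hH | hH
  · exact hS.existsUnique_and_supertrace_eq_zero (one_mul 1)
      (fun X Y => by rw [hH.1 X Y, one_mul]) hC hCH hsymm hcomp
  · exact hS.existsUnique_and_supertrace_eq_zero (by ring) hH.antisymm hC hCH hsymm hcomp
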